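/- Let $(X,\mathcal A,\mu)$ be a $\sigma$-finite measure space with $\mu(X)=\infty$, let $T:X\to X$ be a conservative, ergodic, measure-preserving transformation, and let $Y\in\mathcal A$ with $0<\mu(Y)<\infty$. For a non-negative measurable function $u$ on $X$ let $\mu_u(A)=\int_A u\,d\mu$, and let $\hat T u=d(\mu_u\circ T^{-1})/d\mu$ be the transfer operator. Put $$Y_n=(T^{-n}Y)\setminus\bigcup_{k=0}^{n-1}T^{-k}Y,\qquad w_n^Y=\mu\Big(\bigcup_{k=0}^{n-1}T^{-k}Y\Big),\qquad Z_n^Y(x)=\max\{0\le k\le n: T^kx\in Y\},$$ with $\max\emptyset=0$. Assume: (i) $w_n^Y\sim n^{1-\alpha}\ell(n)$ as $n\to\infty$, where $\alpha\in(0,1)$ and $\ell:(0,\infty)\to(0,\infty)$ is measurable and slowly varying at $\infty$ (that is, $\ell(\lambda t)/\ell(t)\to1$ as $t\to\infty$ for every $\lambda>0$); (ii) there is $N\ge1$ such that the family $\big\{\frac1{w_n^Y}\sum_{k=0}^{n-1}\hat T^k1_{Y_k}\big\}_{n\ge N}$ is uniformly sweeping for $1_Y$, that is, there are $C>0$ and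 an integer $K\ge0$ such that every member $u$ of the family satisfies $C\sum_{j=0}^{K}\hat T^ju\ge 1_Y$ almost everywhere; (iii) $\frac1{w_n^Y}\sum_{k=0}^{n-1}\hat T^k1_{Y_k}\to H$ in $L^\infty(\mu)$ as $n\to\infty$, for some $H\in L^\infty(\mu)$ (so that $H\ge0$ almost everywhere). Let $(c(n))_{n\ge0}$ be a sequence of positive reals with $c(n)\to0$ and $c(n)\,n\to\infty$ as $n\to\infty$. Then for every fixed integer $k\ge0$, $$\mu_H\Big(\frac{Z_n^Y\circ T^k}{n}\le c(n)\Big)=\mu_{\hat T^kH}\Big(\frac{Z_n^Y}{n}\le c(n)\Big)\qquad(n\ge1),$$ and, as $n\to\infty$, both sides are asymptotically equivalent to $$\frac{\sin(\pi\alpha)}{\pi\alpha}\,\frac{c(n)^\alpha\,\ell(n)}{\ell(c(n)n)}.$$ -/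

import Mathlib

open MeasureTheory Filter Topology Asymptotics
open scoped ENNReal NNReal

namespace InfiniteErgodic

/-- A function that is positive and measurable on `(0, ∞)` and slowly varying at `∞`.
Its values on `(-∞, 0]` play no role. -/
structure IsSlowlyVarying (l : ℝ → ℝ) : Prop where
  pos : ∀ t, 0 < t → 0 < l t
  measurable : Measurable (fun t : Set.Ioi (0 : ℝ) => l t)
  tendsto : ∀ r : ℝ, 0 < r → Tendsto (fun t => l (r * t) / l t) atTop (𝓝 1)

variable {X : Type*} [MeasurableSpace X]

/-- The transfer operator on non-negative functions: `u ↦ d(μ_u ∘ T⁻¹)/dμ`, where `μ_u` is the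
measure with density `u` with respect to `μ`. -/
noncomputable def transfer (T : X → X) (μ : Measure X) (u : X → ℝ≥0∞) : X → ℝ≥0∞ :=
  ((μ.withDensity u).map T).rnDeriv μ

/-- A family `F` of non-negative functions is uniformly sweeping for `G`. -/
def UniformlySweeping (T : X → X) (μ : Measure X) (F : Set (X → ℝ≥0∞)) (G : X → ℝ≥0∞) : Prop :=
  ∃ C : ℝ≥0, 0 < C ∧ ∃ K : ℕ, ∀ u ∈ F,
    ∀ᵐ x ∂μ, G x ≤ (C : ℝ≥0∞) * ∑ k ∈ Finset.range (K + 1), (transfer T μ)^[k] u x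

/-- The set `Y_n` of points whose orbit (time `0` included) enters `Y` at time `n` for the
first time. -/
def firstEntrance {X : Type*} (T : X → X) (Y : Set X) (n : ℕ) : Set X :=
  (T^[n] ⁻¹' Y) \ ⋃ k ∈ Finset.range n, T^[k] ⁻¹' Y

/-- The wandering rate `w_n` of `Y`. -/
noncomputable def wanderingRate (T : X → X) (μ : Measure X) (Y : Set X) (n : ℕ) : ℝ≥0∞ :=
  μ (⋃ k ∈ Finset.range n, T^[k] ⁻¹' Y)

/-- The function `(1 / w_n) ∑_{k < n} T̂^k 1_{Y_k}`. -/
noncomputable def entranceDensity (T : X → X) (μ : Measure X) (Y : Set X) (n : ℕ) : X → ℝ≥0∞ :=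
  fun x => (wanderingRate T μ Y n)⁻¹ *
    ∑ k ∈ Finset.range n, (transfer T μ)^[k] ((firstEntrance T Y k).indicator 1) x

open Classical in
/-- The last time `k ∈ {0, …, n}` with `T^k x ∈ Y`, and `0` if there is no such time. -/
noncomputable def lastVisit {X : Type*} (T : X → X) (Y : Set X) (n : ℕ) (x : X) : ℕ :=
  Nat.findGreatest (fun k => T^[k] x ∈ Y) n

end InfiniteErgodic

/-! Write `w` for the wandering rate, β = 1 - α, and m = ⌊c(n) n⌋. The event in question says that
the orbit avoids `Y` at all times in (m, n]. Splitting it by the last visit i ≤ m to `Y` gives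
disjoint pieces T^{-i}E, where E is the set of points of `Y` that do not return for about n steps.
Hence its `μ_H`-measure is, up to harmless shifts, ∑_{i ≤ m} μ_H(T^{-i}E), with a set E that changes
with n. Two asymptotics are needed: one for μ(E), and one for such sums, uniform over measurable E ⊆
Y of positive measure.

For μ(E): the increments of `w` are exactly the measures of the no-return sets, so `w` is concave,
and the monotone density theorem `ConcaveRegVar.tendsto_mul_diff` gives μ(E) ~ β w(n)/n.

For the sums: decomposing T^{-t}E by the first entrance into `Y` gives an exact renewal identity
(`sum_firstEntrance`). The `L^∞` convergence in (iii) replaces ∑_{j ≤ N} μ(Y_j ∩ T^{-j}F) by w(N+1)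
μ_H(F), with error (ε w(N+1) + D) μ(Y ∩ F), where D depends on ε but not on F. Uniform sweeping
bounds μ(Y ∩ F) by finitely many μ_H(T^{-r}F), so after taking generating functions the error is a
small multiple of the main term itself: (1-z)^2 V(z) A(z)/μ(E) → 1, where V and A are the generating
functions of `w` and of i ↦ μ_H(T^{-i}E). An Abelian theorem evaluates V, and a Karamata theorem for
sequences of sequences inverts A: the sum is asymptotic to m μ(E) / (w(m) Γ(1+β) Γ(2-β)). This is
`tendsto_sum_limitMeasure`, and its uniformity in E is what allows E to depend on n.

The product of the two is (m/w(m)) (w(n)/n) β / (Γ(1+β) Γ(2-β)). Euler's reflection formula produces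
the sine, and slow variation turns the ratio of rates into c(n)^α ℓ(n)/ℓ(c(n)n). -/

namespace InfiniteErgodic

/-! ### Concave regularly varying sequences and the monotone density theorem -/

/-- A sequence with `w 0 = 0`, nonincreasing nonnegative increments, positive from `1` on,
and regularly varying of index `β` along integer multiples. -/
structure ConcaveRegVar (w : ℕ → ℝ) (β : ℝ) : Prop where
  zero : w 0 = 0
  pos : ∀ n, 0 < n → 0 < w n
  mono : Monotone w
  anti : Antitone fun n => w (n + 1) - w n
  index_pos : 0 < β
  tendsto : ∀ p : ℕ, 0 < p → Tendsto (fun n => w (p * n) / w n) atTop (𝓝 ((p : ℝ) ^ β))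

namespace ConcaveRegVar

variable {w : ℕ → ℝ} {β : ℝ}

lemma add_sub_le (h : ConcaveRegVar w β) (m d : ℕ) :
    w (m + d) - w m ≤ d * (w (m + 1) - w m) := by
  induction d with
  | zero => simp
  | succ d ih =>
    have := h.anti (Nat.le_add_right m d)
    simp only at this
    rw [← add_assoc]
    push_cast
    linarith

lemma le_add_sub (h : ConcaveRegVar w β) (m d : ℕ) :
    d * (w (m + d + 1) - w (m + d)) ≤ w (m + d) - w m := by
  induction d with
  | zero => simp
  | succ d ih =>
    have := h.anti (Nat.le_succ (m + d))
    simp only [Nat.succ_eq_add_one] at this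
    rw [← add_assoc]
    push_cast
    have h2 : (d : ℝ) * (w (m + d + 1 + 1) - w (m + d + 1)) ≤ d * (w (m + d + 1) - w (m + d)) :=
      mul_le_mul_of_nonneg_left this (Nat.cast_nonneg d)
    linarith

lemma mul_diff_le (h : ConcaveRegVar w β) (n : ℕ) : n * (w (n + 1) - w n) ≤ w n := by
  have := h.le_add_sub 0 n
  simpa [h.zero] using this

lemma nonneg (h : ConcaveRegVar w β) (n : ℕ) : 0 ≤ w n := by
  rw [← h.zero]; exact h.mono (Nat.zero_le n)

lemma subadd (h : ConcaveRegVar w β) (m n : ℕ) : w (m + n) ≤ w m + w n := by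
  induction n with
  | zero => simp [h.zero]
  | succ n ih =>
    have := h.anti (Nat.le_add_left n m)
    simp only at this
    rw [← add_assoc]
    linarith

lemma mul_le (h : ConcaveRegVar w β) (p n : ℕ) : w (p * n) ≤ p * w n := by
  induction p with
  | zero => simp [h.zero]
  | succ p ih =>
    have := h.subadd (p * n) n
    rw [Nat.succ_mul]
    push_cast
    linarith

/-- `w n / n` is nonincreasing. -/
lemma mul_le_mul_of_le (h : ConcaveRegVar w β) {m n : ℕ} (hmn : m ≤ n) : m * w n ≤ n * w m := by
  obtain ⟨d, rfl⟩ := Nat.exists_eq_add_of_le hmn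
  have h1 := h.add_sub_le m d
  have h2 := h.mul_diff_le m
  push_cast
  have hd : (0 : ℝ) ≤ d := Nat.cast_nonneg d
  have hm : (0 : ℝ) ≤ m := Nat.cast_nonneg m
  nlinarith

lemma div_le_max (h : ConcaveRegVar w β) {m n : ℕ} (hn : 0 < n) :
    w m / w n ≤ max 1 ((m : ℝ) / n) := by
  have hn' : (0 : ℝ) < n := Nat.cast_pos.2 hn
  rcases le_total m n with hmn | hmn
  · exact le_max_of_le_left ((div_le_one (h.pos n hn)).2 (h.mono hmn))
  · refine le_max_of_le_right ?_
    rw [div_le_div_iff₀ (h.pos n hn) hn']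
    have := h.mul_le_mul_of_le hmn
    linarith

lemma min_le_div (h : ConcaveRegVar w β) {m n : ℕ} (hn : 0 < n) :
    min 1 ((m : ℝ) / n) ≤ w m / w n := by
  have hn' : (0 : ℝ) < n := Nat.cast_pos.2 hn
  rcases le_total m n with hmn | hmn
  · refine min_le_of_right_le ?_
    rw [div_le_div_iff₀ hn' (h.pos n hn)]
    have := h.mul_le_mul_of_le hmn
    linarith
  · exact min_le_of_left_le ((one_le_div (h.pos n hn)).2 (h.mono hmn))

/-- Monotonicity of `w` and of `w n / n` squeezes the ratio between the minimum and the maximum of 1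
and `m / n`. Concavity thus takes the place of the uniform convergence theorem for regular
variation. -/
lemma tendsto_div_of_tendsto_one (h : ConcaveRegVar w β) {ι : Type*} {f : Filter ι} {m n : ι → ℕ}
    (hn : ∀ᶠ i in f, 0 < n i)
    (hmn : Tendsto (fun i => (m i : ℝ) / n i) f (𝓝 1)) :
    Tendsto (fun i => w (m i) / w (n i)) f (𝓝 1) := by
  have h1 : Tendsto (fun i => min 1 ((m i : ℝ) / n i)) f (𝓝 1) := by
    simpa using (tendsto_const_nhds (x := (1 : ℝ))).min hmn
  have h2 : Tendsto (fun i => max 1 ((m i : ℝ) / n i)) f (𝓝 1) := by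
    simpa using (tendsto_const_nhds (x := (1 : ℝ))).max hmn
  refine tendsto_of_tendsto_of_tendsto_of_le_of_le' h1 h2 ?_ ?_
  · filter_upwards [hn] with i h4 using h.min_le_div h4
  · filter_upwards [hn] with i h4 using h.div_le_max h4

lemma tendsto_floor_mul_div {x : ℝ} (hx : 0 < x) :
    Tendsto (fun N : ℕ => ((⌊x * N⌋₊ + 1 : ℕ) : ℝ) / N) atTop (𝓝 x) := by
  have h1 : Tendsto (fun N : ℕ => (⌊x * (N : ℝ)⌋₊ : ℝ) / N) atTop (𝓝 x) :=
    (tendsto_nat_floor_mul_div_atTop hx.le).comp tendsto_natCast_atTop_atTop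
  have h2 := h1.add (tendsto_one_div_atTop_nhds_zero_nat (𝕜 := ℝ))
  simp only [add_zero] at h2
  refine h2.congr fun N => ?_
  push_cast
  ring

/-- With j = N / r in integer division, both r j and N, and both p j and the floor, are
asymptotically equal, so the ratio is that of w(p j)/w(j) to w(r j)/w(j). -/
lemma tendsto_rat (h : ConcaveRegVar w β) {p r : ℕ} (hp : 0 < p) (hr : 0 < r) :
    Tendsto (fun N : ℕ => w (⌊((p : ℝ) / r) * N⌋₊ + 1) / w N) atTop (𝓝 (((p : ℝ) / r) ^ β)) := by
  have hp' : (0 : ℝ) < p := Nat.cast_pos.2 hp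
  have hr' : (0 : ℝ) < r := Nat.cast_pos.2 hr
  have hj : Tendsto (fun N : ℕ => N / r) atTop atTop := Nat.tendsto_div_const_atTop hr.ne'
  have hjr : Tendsto (fun N : ℕ => ((r * (N / r) : ℕ) : ℝ) / N) atTop (𝓝 1) := by
    have h1 : Tendsto (fun N : ℕ => (⌊(1 / r : ℝ) * (N : ℝ)⌋₊ : ℝ) / N) atTop (𝓝 (1 / r)) :=
      (tendsto_nat_floor_mul_div_atTop (by positivity)).comp tendsto_natCast_atTop_atTop
    have h2 := h1.const_mul (r : ℝ)
    rw [mul_one_div_cancel hr'.ne'] at h2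
    refine h2.congr fun N => ?_
    rw [one_div_mul_eq_div, Nat.floor_div_eq_div]
    push_cast
    ring
  have hpj : Tendsto (fun N : ℕ => ((⌊((p : ℝ) / r) * N⌋₊ + 1 : ℕ) : ℝ) / ((p * (N / r) : ℕ) : ℝ))
      atTop (𝓝 1) := by
    have h1 := (tendsto_floor_mul_div (x := (p : ℝ) / r) (by positivity)).div
      (hjr.const_mul ((p : ℝ) / r)) (by positivity)
    rw [mul_one, div_self (by positivity)] at h1
    refine h1.congr' ?_
    filter_upwards [eventually_gt_atTop 0, hj.eventually_gt_atTop 0] with N hN hN'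
    have : (0 : ℝ) < N := Nat.cast_pos.2 hN
    have : (0 : ℝ) < (N / r : ℕ) := Nat.cast_pos.2 hN'
    simp only [Pi.div_apply]
    push_cast
    field_simp
  have e1 := h.tendsto_div_of_tendsto_one
    (by filter_upwards [hj.eventually_gt_atTop 0] with N hN using Nat.mul_pos hp hN) hpj
  have e2 := h.tendsto_div_of_tendsto_one
    (eventually_gt_atTop 0) hjr
  have e3 := (h.tendsto p hp).comp hj
  have e4 := (h.tendsto r hr).comp hj
  have e5 := (e1.mul (e3.div e4 (by positivity))).mul e2
  rw [one_mul, mul_one, ← Real.div_rpow hp'.le hr'.le] at e5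
  refine e5.congr' ?_
  filter_upwards [eventually_gt_atTop 0, hj.eventually_gt_atTop 0] with N hN hN'
  have a1 := (h.pos _ (Nat.mul_pos hp hN')).ne'
  have a2 := (h.pos _ (Nat.mul_pos hr hN')).ne'
  have a3 := (h.pos _ hN').ne'
  have a4 := (h.pos _ hN).ne'
  simp only [Function.comp, Pi.div_apply]
  field_simp

lemma exists_nat_div_mem_Ioo {a b : ℝ} (ha : 0 ≤ a) (hab : a < b) :
    ∃ p r : ℕ, 0 < p ∧ 0 < r ∧ a < (p : ℝ) / r ∧ (p : ℝ) / r < b := by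
  obtain ⟨y, h1, h2⟩ := exists_rat_btwn hab
  have hy : 0 < y := by exact_mod_cast ha.trans_lt h1
  have hnum : 0 < y.num := Rat.num_pos.2 hy
  have e : ((y.num.toNat : ℕ) : ℝ) / (y.den : ℝ) = (y : ℝ) := by
    rw [Rat.cast_def]
    congr 1
    exact_mod_cast Int.toNat_of_nonneg hnum.le
  exact ⟨y.num.toNat, y.den, by omega, y.pos, by rwa [e], by rwa [e]⟩

/-- Regular variation along real multiples. -/
lemma tendsto_floor (h : ConcaveRegVar w β) {x : ℝ} (hx : 0 < x) :
    Tendsto (fun N : ℕ => w (⌊x * N⌋₊ + 1) / w N) atTop (𝓝 (x ^ β)) := by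
  have hcont : ContinuousAt (fun y : ℝ => y ^ β) x :=
    Real.continuousAt_rpow_const _ _ (Or.inl hx.ne')
  refine tendsto_order.2 ⟨fun a ha => ?_, fun a ha => ?_⟩
  · have h1 : ∀ᶠ y in 𝓝[<] x, a < y ^ β :=
      (hcont.tendsto.mono_left nhdsWithin_le_nhds).eventually (lt_mem_nhds ha)
    obtain ⟨y0, hy0, hy⟩ := mem_nhdsLT_iff_exists_Ioo_subset.1 h1
    -- A rational just below `x`, still with β-th power above `a`, bounds the ratio from below since
    -- `w` is monotone.
    obtain ⟨p, r, hp, hr, hl, hu⟩ := exists_nat_div_mem_Ioo (le_max_left 0 y0)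
      (max_lt hx hy0)
    have h3 : a < ((p : ℝ) / r) ^ β := hy ⟨(le_max_right _ _).trans_lt hl, hu⟩
    filter_upwards [(h.tendsto_rat hp hr).eventually (lt_mem_nhds h3)] with N hN
    refine hN.trans_le (div_le_div_of_nonneg_right (h.mono ?_) (h.nonneg N))
    gcongr
  · have h1 : ∀ᶠ y in 𝓝[>] x, y ^ β < a :=
      (hcont.tendsto.mono_left nhdsWithin_le_nhds).eventually (gt_mem_nhds ha)
    obtain ⟨y0, hy0, hy⟩ := mem_nhdsGT_iff_exists_Ioo_subset.1 h1
    obtain ⟨p, r, hp, hr, hl, hu⟩ := exists_nat_div_mem_Ioo hx.le (Set.mem_Ioi.1 hy0)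
    have h3 : ((p : ℝ) / r) ^ β < a := hy ⟨hl, hu⟩
    filter_upwards [(h.tendsto_rat hp hr).eventually (gt_mem_nhds h3)] with N hN
    refine (div_le_div_of_nonneg_right (h.mono ?_) (h.nonneg N)).trans_lt hN
    gcongr

/-- A finite limit would force w(2n)/w(n) → 1, whereas the limit is 2^β > 1. -/
lemma tendsto_atTop (h : ConcaveRegVar w β) : Tendsto w atTop atTop := by
  rcases tendsto_atTop_of_monotone h.mono with h1 | ⟨L, hL⟩
  · exact h1
  exfalso
  have hLpos : 0 < L := (h.pos 1 one_pos).trans_le (h.mono.ge_of_tendsto hL 1)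
  have h2 : Tendsto (fun n : ℕ => 2 * n) atTop atTop :=
    tendsto_id.const_mul_atTop' two_pos
  have h3 := (hL.comp h2).div hL hLpos.ne'
  rw [div_self hLpos.ne'] at h3
  have h4 := tendsto_nhds_unique h3 (h.tendsto 2 two_pos)
  have h5 : (1 : ℝ) < ((2 : ℕ) : ℝ) ^ β := Real.one_lt_rpow (by norm_num) h.index_pos
  exact h5.ne h4

/-- This linear bound, uniform in `N`, supplies the dominating function for the Laplace transform.
-/
lemma bound (h : ConcaveRegVar w β) {x : ℝ} (hx : 0 ≤ x) {N : ℕ} (hN : 0 < N) :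
    w (⌊x * N⌋₊ + 1) ≤ (x + 2) * w N := by
  have h1 : ⌊x * N⌋₊ + 1 ≤ (⌈x⌉₊ + 1) * N := by
    have : ⌊x * N⌋₊ ≤ ⌈x⌉₊ * N := by
      apply Nat.floor_le_of_le
      push_cast
      gcongr
      exact Nat.le_ceil x
    nlinarith
  refine (h.mono h1).trans ((h.mul_le _ _).trans ?_)
  gcongr
  · exact h.nonneg N
  · push_cast
    linarith [Nat.ceil_lt_add_one hx]

/-- The monotone density theorem. -/
lemma tendsto_mul_diff (h : ConcaveRegVar w β) :
    Tendsto (fun n : ℕ => n * (w (n + 1) - w n) / w n) atTop (𝓝 β) := by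
  have hslope : Tendsto (slope (fun y : ℝ => y ^ β) 1) (𝓝[≠] 1) (𝓝 β) := by
    have := (Real.hasDerivAt_rpow_const (x := 1) (p := β) (Or.inl one_ne_zero))
    simpa using hasDerivAt_iff_tendsto_slope.1 this
  have hsl : ∀ b : ℝ, slope (fun y : ℝ => y ^ β) 1 b = (b ^ β - 1) / (b - 1) := fun b => by
    simp [slope_def_field]
  refine tendsto_order.2 ⟨fun a ha => ?_, fun a ha => ?_⟩
  · have h1 : ∀ᶠ y in 𝓝[>] (1 : ℝ), a < slope (fun y : ℝ => y ^ β) 1 y :=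
      (hslope.mono_left (nhdsWithin_mono _ fun y hy => ne_of_gt hy)).eventually (lt_mem_nhds ha)
    -- Choose b > 1 whose chord slope (b^β - 1)/(b - 1) exceeds `a`. By concavity the increment at
    -- `n` dominates the average increment of `w` over [n, bn], which is asymptotic to that slope
    -- times w(n)/n.
    obtain ⟨b, hb, hb1⟩ := (h1.and self_mem_nhdsWithin).exists
    have hb1 : (1 : ℝ) < b := hb1
    rw [hsl] at hb
    have h2 := ((h.tendsto_floor (x := b) (by linarith)).sub_const 1).div
      ((tendsto_floor_mul_div (x := b) (by linarith)).sub_const 1) (by linarith)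
    filter_upwards [h2.eventually (lt_mem_nhds hb), eventually_gt_atTop 0] with n hn hn0
    refine hn.trans_le ?_
    have hn0' : (0 : ℝ) < n := Nat.cast_pos.2 hn0
    have hlt : n < ⌊b * n⌋₊ + 1 := by
      have : (n : ℝ) < (⌊b * n⌋₊ + 1 : ℕ) := by
        push_cast
        refine lt_of_le_of_lt ?_ (Nat.lt_floor_add_one _)
        nlinarith
      exact_mod_cast this
    obtain ⟨d, hd⟩ := Nat.exists_eq_add_of_le hlt.le
    have hd0 : (0 : ℝ) < d := by
      have : 0 < d := by omega
      exact_mod_cast this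
    simp only [Pi.div_apply]
    rw [hd]
    have e := h.add_sub_le n d
    have hw := h.pos n hn0
    have e1 : w (n + d) / w n - 1 = (w (n + d) - w n) / w n := by field_simp
    have e2 : ((n + d : ℕ) : ℝ) / n - 1 = d / n := by push_cast; field_simp; ring
    rw [e1, e2, div_div_eq_mul_div, div_le_iff₀ hd0]
    rw [div_mul_eq_mul_div, div_mul_eq_mul_div]
    gcongr ?_ / _
    nlinarith
  · have h1 : ∀ᶠ y in 𝓝[<] (1 : ℝ), slope (fun y : ℝ => y ^ β) 1 y < a :=
      (hslope.mono_left (nhdsWithin_mono _ fun y hy => ne_of_lt hy)).eventually (gt_mem_nhds ha)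
    -- Mirror image: with b < 1, the increment at `n` is at most the average increment over [bn, n].
    obtain ⟨b, ⟨hb, hb1⟩, hb0⟩ := ((h1.and self_mem_nhdsWithin).and
      (nhdsWithin_le_nhds (lt_mem_nhds (zero_lt_one' ℝ)))).exists
    have hb1 : b < 1 := hb1
    have hb0 : 0 < b := hb0
    rw [hsl] at hb
    have h2 := ((h.tendsto_floor (x := b) (by linarith)).sub_const 1).div
      ((tendsto_floor_mul_div (x := b) (by linarith)).sub_const 1) (by linarith)
    have h3 := (tendsto_floor_mul_div (x := b) (by linarith)).eventually (gt_mem_nhds hb1)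
    filter_upwards [h2.eventually (gt_mem_nhds hb), eventually_gt_atTop 0, h3] with n hn hn0 hn1
    refine lt_of_le_of_lt ?_ hn
    have hn0' : (0 : ℝ) < n := Nat.cast_pos.2 hn0
    rw [div_lt_one hn0', Nat.cast_lt] at hn1
    simp only [Pi.div_apply]
    generalize ⌊b * (n : ℝ)⌋₊ + 1 = m at hn hn1 ⊢
    obtain ⟨d, rfl⟩ := Nat.exists_eq_add_of_le hn1.le
    have hd0 : (0 : ℝ) < d := by
      have : 0 < d := by omega
      exact_mod_cast this
    have e := h.le_add_sub m d
    have hw := h.pos _ hn0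
    have e1 : w m / w (m + d) - 1 = - ((w (m + d) - w m) / w (m + d)) := by field_simp; ring
    have e2 : (m : ℝ) / ((m + d : ℕ) : ℝ) - 1 = - (d / ((m + d : ℕ) : ℝ)) := by
      push_cast at hn0' ⊢; field_simp; ring
    rw [e1, e2, neg_div_neg_eq, div_div_eq_mul_div, le_div_iff₀ hd0]
    rw [div_mul_eq_mul_div, div_mul_eq_mul_div]
    gcongr ?_ / _
    nlinarith

lemma eventually_diff_pos (h : ConcaveRegVar w β) : ∀ᶠ n in atTop, 0 < w (n + 1) - w n := by
  filter_upwards [h.tendsto_mul_diff.eventually (lt_mem_nhds h.index_pos)] with n hn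
  by_contra! hc
  have : n * (w (n + 1) - w n) / w n ≤ 0 :=
    div_nonpos_of_nonpos_of_nonneg (mul_nonpos_of_nonneg_of_nonpos (Nat.cast_nonneg n) hc)
      (h.nonneg n)
  linarith

end ConcaveRegVar
end InfiniteErgodic

/-! ### The Abelian theorem for generating functions -/

namespace InfiniteErgodic

/-- The integrand is constant on intervals of length 1/N, so a series is an integral exactly. This
lets dominated convergence handle the rescaled series. -/
lemma hasSum_integral_floor_mul {N : ℝ} (hN : 0 < N) {g : ℕ → ℝ}
    (hg : IntegrableOn (fun x : ℝ => g ⌊x * N⌋₊) (Set.Ici 0)) :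
    HasSum (fun n => N⁻¹ * g n) (∫ x in Set.Ici (0 : ℝ), g ⌊x * N⌋₊) := by
  have hmem : ∀ (n : ℕ) (x : ℝ), x ∈ Set.Ico (n / N) ((n + 1) / N) → ⌊x * N⌋₊ = n := by
    intro n x hx
    rw [Set.mem_Ico, div_le_iff₀ hN, lt_div_iff₀ hN] at hx
    exact (Nat.floor_eq_iff ((Nat.cast_nonneg n).trans hx.1)).2 hx
  have hU : (⋃ n : ℕ, Set.Ico ((n : ℝ) / N) ((n + 1) / N)) = Set.Ici 0 := by
    ext x
    simp only [Set.mem_iUnion, Set.mem_Ico, Set.mem_Ici, div_le_iff₀ hN, lt_div_iff₀ hN]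
    constructor
    · rintro ⟨n, hn, _⟩
      exact nonneg_of_mul_nonneg_left ((Nat.cast_nonneg n).trans hn) hN
    · intro hx
      exact ⟨⌊x * N⌋₊, Nat.floor_le (by positivity), Nat.lt_floor_add_one _⟩
  have hd : Pairwise (Function.onFun Disjoint fun n : ℕ => Set.Ico ((n : ℝ) / N) ((n + 1) / N)) := by
    intro i j hij
    refine Set.disjoint_left.2 fun x hi hj => hij ?_
    rw [← hmem i x hi, hmem j x hj]
  rw [← hU] at hg ⊢
  refine (hasSum_integral_iUnion (fun n => measurableSet_Ico) hd hg).congr_fun ?_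
  intro n
  rw [setIntegral_congr_fun measurableSet_Ico
    (g := fun _ => g n) (fun x hx => by simp only [hmem n x hx])]
  have : ((n : ℝ) + 1) / N - n / N = N⁻¹ := by field_simp; ring
  simp [this, hN.le]

lemma tendsto_mul_one_sub_exp (t : ℝ) :
    Tendsto (fun N : ℕ => (N : ℝ) * (1 - Real.exp (-(t / N)))) atTop (𝓝 t) := by
  rcases eq_or_ne t 0 with rfl | ht
  · simp
  have h1 : Tendsto (slope Real.exp 0) (𝓝[≠] 0) (𝓝 1) := by
    simpa using hasDerivAt_iff_tendsto_slope.1 (Real.hasDerivAt_exp 0)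
  have h2 : Tendsto (fun N : ℕ => -(t / (N : ℝ))) atTop (𝓝[≠] 0) := by
    refine tendsto_nhdsWithin_iff.2 ⟨?_, ?_⟩
    · simpa using (tendsto_const_div_atTop_nhds_zero_nat t).neg
    · filter_upwards [eventually_gt_atTop 0] with N hN
      have : (0 : ℝ) < N := Nat.cast_pos.2 hN
      simp [ht, this.ne']
  have h3 := (h1.comp h2).const_mul t
  rw [mul_one] at h3
  refine h3.congr' ?_
  filter_upwards [eventually_gt_atTop 0] with N hN
  have : (0 : ℝ) < N := Nat.cast_pos.2 hN
  simp only [Function.comp, slope_def_field, Real.exp_zero, sub_zero]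
  field_simp
  ring

namespace ConcaveRegVar

variable {w : ℕ → ℝ} {β : ℝ}

lemma le_nat_mul (h : ConcaveRegVar w β) (n : ℕ) : w n ≤ n * w 1 := by
  simpa using h.mul_le n 1

lemma summable_pow_mul (h : ConcaveRegVar w β) {z : ℝ} (hz : 0 ≤ z) (hz1 : z < 1) :
    Summable fun n : ℕ => z ^ n * w (n + 1) := by
  have h1 : Summable fun n : ℕ => (n : ℝ) ^ 1 * z ^ n :=
    summable_pow_mul_geometric_of_norm_lt_one 1 (by rwa [Real.norm_of_nonneg hz])
  have h2 : Summable fun n : ℕ => z ^ n := summable_geometric_of_lt_one hz hz1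
  refine Summable.of_nonneg_of_le (fun n => mul_nonneg (pow_nonneg hz n) (h.nonneg _))
    (fun n => ?_) ((h1.add h2).mul_left (w 1))
  have := h.le_nat_mul (n + 1)
  push_cast at this
  have h3 := mul_le_mul_of_nonneg_left this (pow_nonneg hz n)
  linarith

/-- The Abelian theorem for the Laplace transform of `w`. -/
lemma tendsto_laplace (h : ConcaveRegVar w β) {t : ℝ} (ht : 0 < t) :
    Tendsto (fun N : ℕ => (1 - Real.exp (-(t / N))) *
      (∑' n, Real.exp (-(t / N)) ^ n * w (n + 1)) / w N) atTop
      (𝓝 (t ^ (-β) * Real.Gamma (β + 1))) := by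
  set F : ℕ → ℝ → ℝ := fun N x =>
    Real.exp (-(t / N)) ^ ⌊x * N⌋₊ * w (⌊x * N⌋₊ + 1) / w N with hF
  -- The factor e^t pays for rounding the exponent down, and half of the decay e^{-tx} absorbs the
  -- linear growth x + 2 of the ratio of `w`.
  set bd : ℝ → ℝ := fun x => Real.exp t * (2 / t + 2) * Real.exp (-(t / 2) * x) with hbd
  have hbdint : IntegrableOn bd (Set.Ici 0) := by
    rw [integrableOn_Ici_iff_integrableOn_Ioi]
    exact (exp_neg_integrableOn_Ioi 0 (half_pos ht)).const_mul _
  have hmeas : ∀ N, Measurable (F N) := fun N => by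
    have : F N = (fun k : ℕ => Real.exp (-(t / N)) ^ k * w (k + 1) / w N) ∘
      fun x : ℝ => ⌊x * N⌋₊ := rfl
    rw [this]
    exact measurable_from_top.comp (Nat.measurable_floor.comp (measurable_id.mul_const _))
  have hle : ∀ N : ℕ, 0 < N → ∀ x : ℝ, 0 ≤ x → ‖F N x‖ ≤ bd x := by
    intro N hN x hx
    have hN' : (0 : ℝ) < N := Nat.cast_pos.2 hN
    have hN1 : (1 : ℝ) ≤ N := Nat.one_le_cast.2 hN
    have hw := h.pos N hN
    rw [Real.norm_of_nonneg (div_nonneg (mul_nonneg (by positivity) (h.nonneg _)) hw.le)]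
    have e1 : Real.exp (-(t / N)) ^ ⌊x * N⌋₊ ≤ Real.exp t * Real.exp (-t * x) := by
      rw [← Real.exp_nat_mul, ← Real.exp_add]
      apply Real.exp_le_exp.2
      have f1 : x * N < ⌊x * N⌋₊ + 1 := Nat.lt_floor_add_one _
      have f2 : t / N ≤ t := div_le_self ht.le hN1
      have f3 : 0 < t / N := by positivity
      have f4 : t / N * (x * N) = t * x := by field_simp
      nlinarith
    have e2 : w (⌊x * N⌋₊ + 1) / w N ≤ x + 2 := (div_le_iff₀ hw).2 (h.bound hx hN)
    have e3 : x + 2 ≤ (2 / t + 2) * Real.exp (t / 2 * x) := by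
      have f1 : t / 2 * x + 1 ≤ Real.exp (t / 2 * x) := Real.add_one_le_exp _
      have f2 : x ≤ 2 / t * Real.exp (t / 2 * x) := by
        have : x = 2 / t * (t / 2 * x) := by field_simp
        calc x = 2 / t * (t / 2 * x) := this
          _ ≤ _ := by gcongr; linarith
      have f3 : 0 ≤ t / 2 * x := by positivity
      linarith
    have e4 : Real.exp (-t * x) * Real.exp (t / 2 * x) = Real.exp (-(t / 2) * x) := by
      rw [← Real.exp_add]; ring_nf
    calc F N x = Real.exp (-(t / N)) ^ ⌊x * N⌋₊ * (w (⌊x * N⌋₊ + 1) / w N) := by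
          simp only [hF, mul_div_assoc]
      _ ≤ (Real.exp t * Real.exp (-t * x)) * ((2 / t + 2) * Real.exp (t / 2 * x)) :=
          mul_le_mul e1 (e2.trans e3) (div_nonneg (h.nonneg _) hw.le) (by positivity)
      _ = Real.exp t * (2 / t + 2) * (Real.exp (-t * x) * Real.exp (t / 2 * x)) := by ring
      _ = bd x := by rw [e4]
  have hlim : Tendsto (fun N => ∫ x in Set.Ici (0 : ℝ), F N x) atTop
      (𝓝 (∫ x in Set.Ici (0 : ℝ), Real.exp (-(t * x)) * x ^ β)) := by
    refine tendsto_integral_filter_of_dominated_convergence bd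
      (Eventually.of_forall fun N => (hmeas N).aestronglyMeasurable) ?_ hbdint ?_
    · filter_upwards [eventually_gt_atTop 0] with N hN
      filter_upwards [ae_restrict_mem measurableSet_Ici] with x hx using hle N hN x hx
    · rw [← restrict_Ioi_eq_restrict_Ici]
      filter_upwards [ae_restrict_mem measurableSet_Ioi] with x hx
      have hx : 0 < x := hx
      have f1 : Tendsto (fun N : ℕ => Real.exp (-(t / N)) ^ ⌊x * N⌋₊) atTop
          (𝓝 (Real.exp (-(t * x)))) := by
        simp_rw [← Real.exp_nat_mul]
        refine (Real.continuous_exp.tendsto _).comp ?_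
        have g1 : Tendsto (fun N : ℕ => (⌊x * (N : ℝ)⌋₊ : ℝ) / N) atTop (𝓝 x) :=
          (tendsto_nat_floor_mul_div_atTop hx.le).comp tendsto_natCast_atTop_atTop
        refine (g1.const_mul t).neg.congr fun N => ?_
        ring
      refine (f1.mul (h.tendsto_floor hx)).congr fun N => ?_
      simp only [hF, mul_div_assoc]
  have hval : ∫ x in Set.Ici (0 : ℝ), Real.exp (-(t * x)) * x ^ β =
      (1 / t) ^ (β + 1) * Real.Gamma (β + 1) := by
    rw [integral_Ici_eq_integral_Ioi,
      ← Real.integral_rpow_mul_exp_neg_mul_Ioi (by linarith [h.index_pos]) ht]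
    refine setIntegral_congr_fun measurableSet_Ioi fun x _ => ?_
    simp only [add_sub_cancel_right]
    ring
  have hfin := (tendsto_mul_one_sub_exp t).mul hlim
  have hc : t * ((1 / t) ^ (β + 1) * Real.Gamma (β + 1)) = t ^ (-β) * Real.Gamma (β + 1) := by
    rw [← mul_assoc, one_div, Real.inv_rpow ht.le, ← Real.rpow_neg ht.le]
    congr 1
    nth_rewrite 1 [← Real.rpow_one t]
    rw [← Real.rpow_add ht]
    congr 1
    ring
  rw [hval, hc] at hfin
  refine hfin.congr' ?_
  filter_upwards [eventually_gt_atTop 0] with N hN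
  have hN' : (0 : ℝ) < N := Nat.cast_pos.2 hN
  have hint : IntegrableOn (F N) (Set.Ici 0) :=
    Integrable.mono' hbdint (hmeas N).aestronglyMeasurable (by
      filter_upwards [ae_restrict_mem measurableSet_Ici] with x hx using hle N hN x hx)
  have hs := hasSum_integral_floor_mul hN'
    (g := fun k => Real.exp (-(t / N)) ^ k * w (k + 1) / w N) hint
  have hs' := hs.tsum_eq
  rw [tsum_mul_left, tsum_div_const] at hs'
  simp only [hF]
  rw [← hs']
  field_simp

end ConcaveRegVar
end InfiniteErgodic

/-! ### Karamata's Tauberian theorem by the method of moments -/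

namespace InfiniteErgodic

/-- The method of moments on `[0, 1]`. -/
lemma tendsto_integral_of_tendsto_moments {ι : Type*} {f : Filter ι} {σ : ι → Measure ℝ}
    {τ : Measure ℝ} [∀ i, IsFiniteMeasure (σ i)] [IsFiniteMeasure τ]
    (hσ : ∀ i, ∀ᵐ x ∂σ i, x ∈ Set.Icc (0 : ℝ) 1) (hτ : ∀ᵐ x ∂τ, x ∈ Set.Icc (0 : ℝ) 1)
    (hm : ∀ k : ℕ, Tendsto (fun i => ∫ x, x ^ k ∂σ i) f (𝓝 (∫ x, x ^ k ∂τ)))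
    {g : ℝ → ℝ} (hg : Continuous g) :
    Tendsto (fun i => ∫ x, g x ∂σ i) f (𝓝 (∫ x, g x ∂τ)) := by
  have hint : ∀ (ρ : Measure ℝ) [IsFiniteMeasure ρ], (∀ᵐ x ∂ρ, x ∈ Set.Icc (0 : ℝ) 1) →
      ∀ φ : ℝ → ℝ, Continuous φ → Integrable φ ρ := by
    intro ρ _ hρ φ hφ
    obtain ⟨C, hC⟩ := isCompact_Icc.exists_bound_of_continuousOn (s := Set.Icc (0 : ℝ) 1)
      hφ.continuousOn
    exact Integrable.of_bound hφ.aestronglyMeasurable C (hρ.mono hC)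
  have hpoly : ∀ p : Polynomial ℝ,
      Tendsto (fun i => ∫ x, p.eval x ∂σ i) f (𝓝 (∫ x, p.eval x ∂τ)) := by
    intro p
    induction p using Polynomial.induction_on' with
    | add p q hp hq =>
      simp only [Polynomial.eval_add]
      have e : ∀ (ρ : Measure ℝ) [IsFiniteMeasure ρ], (∀ᵐ x ∂ρ, x ∈ Set.Icc (0 : ℝ) 1) →
          ∫ x, (p.eval x + q.eval x) ∂ρ = ∫ x, p.eval x ∂ρ + ∫ x, q.eval x ∂ρ :=
        fun ρ _ hρ => integral_add (hint ρ hρ _ p.continuous) (hint ρ hρ _ q.continuous)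
      rw [e τ hτ]
      exact (hp.add hq).congr fun i => (e (σ i) (hσ i)).symm
    | monomial n a =>
      simp only [Polynomial.eval_monomial, integral_const_mul]
      exact (hm n).const_mul a
  have hclose : ∀ (ρ : Measure ℝ) [IsFiniteMeasure ρ], (∀ᵐ x ∂ρ, x ∈ Set.Icc (0 : ℝ) 1) →
      ∀ (p : Polynomial ℝ) (ε : ℝ), (∀ x ∈ Set.Icc (0 : ℝ) 1, |p.eval x - g x| < ε) →
      |∫ x, p.eval x ∂ρ - ∫ x, g x ∂ρ| ≤ ε * ρ.real Set.univ := by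
    intro ρ _ hρ p ε hp
    rw [← integral_sub (hint ρ hρ _ p.continuous) (hint ρ hρ _ hg), ← Real.norm_eq_abs]
    exact norm_integral_le_of_norm_le_const (hρ.mono fun x hx => (hp x hx).le)
  have hmass : Tendsto (fun i => (σ i).real Set.univ) f (𝓝 (τ.real Set.univ)) := by
    simpa using hm 0
  set M := τ.real Set.univ
  have hM : 0 ≤ M := measureReal_nonneg
  rw [Metric.tendsto_nhds]
  intro η hη
  -- Weierstrass approximation; the masses of `σ i` are eventually below M + 1, so each replacement
  -- of `g` by `p` costs at most η/3.
  obtain ⟨p, hp⟩ := exists_polynomial_near_of_continuousOn 0 1 g hg.continuousOn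
    (η / (3 * (M + 1))) (by positivity)
  have h1 := hclose τ hτ p _ hp
  filter_upwards [hmass.eventually (gt_mem_nhds (lt_add_one M)),
    (Metric.tendsto_nhds.1 (hpoly p)) (η / 3) (by positivity)] with i hi1 hi2
  have h2 := hclose (σ i) (hσ i) p _ hp
  rw [Real.dist_eq] at hi2 ⊢
  have e : η / (3 * (M + 1)) * (M + 1) = η / 3 := by field_simp
  have h3 : η / (3 * (M + 1)) * M < η / 3 := by
    rw [← e]; gcongr; linarith
  have h4 : η / (3 * (M + 1)) * (σ i).real Set.univ < η / 3 := by
    rw [← e]; gcongr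
  rw [abs_lt] at hi2 ⊢
  rw [abs_le] at h1 h2
  constructor <;> linarith

/-- The law of `exp (-x)` when `x` has the Gamma distribution with shape `α`. -/
noncomputable def expGamma (α : ℝ) : Measure ℝ :=
  (ProbabilityTheory.gammaMeasure α 1).map fun x => Real.exp (-x)

lemma integral_expGamma {α : ℝ} (hα : 0 < α) {g : ℝ → ℝ} (hg : Measurable g) :
    ∫ t, g t ∂expGamma α =
      ∫ x in Set.Ioi (0 : ℝ), (Real.Gamma α)⁻¹ * (x ^ (α - 1) * Real.exp (-x)) *
        g (Real.exp (-x)) := by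
  have hmeas : Measurable (ProbabilityTheory.gammaPDF α 1) :=
    (ProbabilityTheory.measurable_gammaPDFReal α 1).ennreal_ofReal
  rw [expGamma, integral_map (by fun_prop) hg.aestronglyMeasurable,
    ProbabilityTheory.gammaMeasure, integral_withDensity_eq_integral_toReal_smul hmeas
      (Eventually.of_forall fun x => ENNReal.ofReal_lt_top),
    ← integral_Ici_eq_integral_Ioi, ← integral_indicator measurableSet_Ici]
  congr 1 with x
  rw [ProbabilityTheory.gammaPDF, ENNReal.toReal_ofReal
    (ProbabilityTheory.gammaPDFReal_nonneg hα one_pos x), ProbabilityTheory.gammaPDFReal]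
  by_cases hx : 0 ≤ x
  · rw [Set.indicator_of_mem (Set.mem_Ici.2 hx)]
    simp [hx, mul_assoc]
  · rw [Set.indicator_of_notMem (by simpa using hx)]
    simp [hx]

/-- These moments are the prescribed Laplace limits at k + 1; the shift arises because the
approximating measures below carry an extra factor t in their weights. -/
lemma expGamma_moment {α : ℝ} (hα : 0 < α) (k : ℕ) :
    ∫ t, t ^ k ∂expGamma α = ((k + 1 : ℕ) : ℝ) ^ (-α) := by
  rw [integral_expGamma hα (by fun_prop : Measurable fun t : ℝ => t ^ k)]
  have e : ∀ x : ℝ, (Real.Gamma α)⁻¹ * (x ^ (α - 1) * Real.exp (-x)) * Real.exp (-x) ^ k =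
      (Real.Gamma α)⁻¹ * (x ^ (α - 1) * Real.exp (-(((k + 1 : ℕ) : ℝ) * x))) := by
    intro x
    rw [← Real.exp_nat_mul, mul_assoc, mul_assoc, ← Real.exp_add]
    push_cast
    ring_nf
  simp_rw [e]
  rw [integral_const_mul, Real.integral_rpow_mul_exp_neg_mul_Ioi hα (by positivity), one_div,
    Real.inv_rpow (by positivity), ← Real.rpow_neg (by positivity), mul_comm, mul_assoc,
    mul_inv_cancel₀ (Real.Gamma_pos_of_pos hα).ne', mul_one]

lemma isProbabilityMeasure_expGamma {α : ℝ} (hα : 0 < α) : IsProbabilityMeasure (expGamma α) := by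
  have := ProbabilityTheory.isProbabilityMeasure_gammaMeasure hα one_pos
  exact Measure.isProbabilityMeasure_map (by fun_prop)

lemma expGamma_ae_mem {α : ℝ} : ∀ᵐ t ∂expGamma α, t ∈ Set.Icc (0 : ℝ) 1 := by
  have hmeas : Measurable (ProbabilityTheory.gammaPDF α 1) :=
    (ProbabilityTheory.measurable_gammaPDFReal α 1).ennreal_ofReal
  refine (ae_map_iff (p := fun t => t ∈ Set.Icc (0 : ℝ) 1) (by fun_prop) measurableSet_Icc).2 ?_
  rw [ProbabilityTheory.gammaMeasure, ae_withDensity_iff hmeas]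
  refine Eventually.of_forall fun x hx => ?_
  have : 0 ≤ x := by
    by_contra! hc
    exact hx (ProbabilityTheory.gammaPDF_of_neg hc)
  exact ⟨(Real.exp_pos _).le, Real.exp_le_one_iff.2 (by linarith)⟩

/-- A continuous function on `ℝ` vanishing on `(-∞, a]` and equal to `1 / t` on `[b, ∞)`. -/
noncomputable def rampInv (a b t : ℝ) : ℝ := max 0 (min 1 ((t - a) / (b - a))) / max t a

lemma continuous_rampInv {a b : ℝ} (ha : 0 < a) : Continuous (rampInv a b) := by
  unfold rampInv
  refine Continuous.div (by fun_prop) (by fun_prop) fun t => ?_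
  exact (ha.trans_le (le_max_right _ _)).ne'

lemma rampInv_nonneg {a b : ℝ} (ha : 0 < a) (t : ℝ) : 0 ≤ rampInv a b t :=
  div_nonneg (le_max_left _ _) (ha.le.trans (le_max_right _ _))

lemma rampInv_of_le {a b t : ℝ} (hab : a < b) (ht : t ≤ a) : rampInv a b t = 0 := by
  have h : (t - a) / (b - a) ≤ 0 := div_nonpos_of_nonpos_of_nonneg (by linarith) (by linarith)
  simp [rampInv, max_eq_left ((min_le_right _ _).trans h)]

lemma mul_rampInv_le_one {a b t : ℝ} (ha : 0 < a) (ht : 0 ≤ t) : t * rampInv a b t ≤ 1 := by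
  have h1 : 0 < max t a := ha.trans_le (le_max_right _ _)
  rw [rampInv, ← mul_div_assoc, div_le_one h1]
  calc t * max 0 (min 1 ((t - a) / (b - a))) ≤ t * 1 := by
        gcongr
        exact max_le zero_le_one (min_le_left _ _)
    _ ≤ max t a := by simp

lemma mul_rampInv_of_ge {a b t : ℝ} (ha : 0 < a) (hab : a < b) (ht : b ≤ t) :
    t * rampInv a b t = 1 := by
  have h1 : 1 ≤ (t - a) / (b - a) := (one_le_div (by linarith)).2 (by linarith)
  rw [rampInv, min_eq_left h1, max_eq_right zero_le_one, max_eq_left (by linarith),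
    mul_one_div_cancel (by linarith)]

lemma setIntegral_rpow {α y : ℝ} (hα : 0 < α) (hy : 0 < y) :
    ∫ x in Set.Ioc 0 y, (Real.Gamma α)⁻¹ * x ^ (α - 1) = y ^ α / Real.Gamma (α + 1) := by
  rw [integral_const_mul, ← intervalIntegral.integral_of_le hy.le,
    integral_rpow (Or.inl (by linarith)), Real.Gamma_add_one hα.ne']
  simp only [sub_add_cancel, Real.zero_rpow hα.ne', sub_zero]
  have := Real.Gamma_pos_of_pos hα
  field_simp

lemma integrableOn_rpow {α y : ℝ} (hα : 0 < α) (hy : 0 < y) :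
    IntegrableOn (fun x : ℝ => (Real.Gamma α)⁻¹ * x ^ (α - 1)) (Set.Ioc 0 y) :=
  Integrable.const_mul ((intervalIntegrable_iff_integrableOn_Ioc_of_le hy.le).1
    (intervalIntegral.intervalIntegrable_rpow' (by linarith))) _

/-- The factor e^{-x} of the Gamma density cancels the 1/t in the ramp, leaving a constant times
x^{α-1} times a cutoff. The cutoff vanishes once e^{-x} ≤ a, which truncates the domain. -/
lemma integral_rampInv_aux {α a b : ℝ} (hα : 0 < α) (ha : 0 < a) (ha1 : a < 1) (hab : a < b) :
    IntegrableOn (fun x : ℝ => (Real.Gamma α)⁻¹ * (x ^ (α - 1)) *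
      (Real.exp (-x) * rampInv a b (Real.exp (-x)))) (Set.Ioc 0 (-Real.log a)) ∧
    ∫ t, rampInv a b t ∂expGamma α = ∫ x in Set.Ioc 0 (-Real.log a),
      (Real.Gamma α)⁻¹ * (x ^ (α - 1)) * (Real.exp (-x) * rampInv a b (Real.exp (-x))) := by
  have hy : 0 < -Real.log a := by linarith [Real.log_neg ha ha1]
  have hr := continuous_rampInv (a := a) (b := b) ha
  constructor
  · refine Integrable.mono' (integrableOn_rpow hα hy) ?_ ?_
    · refine Measurable.aestronglyMeasurable ?_
      have := hr.measurable
      fun_prop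
    · filter_upwards [ae_restrict_mem measurableSet_Ioc] with x hx
      have hx0 : 0 < x := hx.1
      have hG := Real.Gamma_pos_of_pos hα
      have e0 : 0 ≤ Real.exp (-x) * rampInv a b (Real.exp (-x)) :=
        mul_nonneg (Real.exp_pos _).le (rampInv_nonneg ha _)
      rw [Real.norm_of_nonneg (by positivity)]
      exact mul_le_of_le_one_right (by positivity) (mul_rampInv_le_one ha (Real.exp_pos _).le)
  · rw [integral_expGamma hα hr.measurable]
    have e : ∀ x : ℝ, (Real.Gamma α)⁻¹ * (x ^ (α - 1) * Real.exp (-x)) *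
        rampInv a b (Real.exp (-x)) = (Real.Gamma α)⁻¹ * (x ^ (α - 1)) *
          (Real.exp (-x) * rampInv a b (Real.exp (-x))) := fun x => by ring
    simp_rw [e]
    refine setIntegral_eq_of_subset_of_forall_sdiff_eq_zero measurableSet_Ioi
      (fun x hx => hx.1) fun x hx => ?_
    have hx0 : 0 < x := hx.1
    have hx1 : -Real.log a < x := by
      by_contra! hc
      exact hx.2 ⟨hx0, hc⟩
    rw [rampInv_of_le hab, mul_zero, mul_zero]
    rw [← Real.exp_log ha]
    exact Real.exp_le_exp.2 (by linarith)

lemma integral_rampInv_le {α a b : ℝ} (hα : 0 < α) (ha : 0 < a) (ha1 : a < 1) (hab : a < b) :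
    ∫ t, rampInv a b t ∂expGamma α ≤ (-Real.log a) ^ α / Real.Gamma (α + 1) := by
  have hy : 0 < -Real.log a := by linarith [Real.log_neg ha ha1]
  obtain ⟨h1, h2⟩ := integral_rampInv_aux (b := b) hα ha ha1 hab
  rw [h2, ← setIntegral_rpow hα hy]
  refine setIntegral_mono_on h1 (integrableOn_rpow hα hy) measurableSet_Ioc fun x hx => ?_
  have hx0 : 0 < x := hx.1
  have hG := Real.Gamma_pos_of_pos hα
  exact mul_le_of_le_one_right (by positivity) (mul_rampInv_le_one ha (Real.exp_pos _).le)

lemma le_integral_rampInv {α a b : ℝ} (hα : 0 < α) (ha : 0 < a) (hab : a < b) (hb1 : b < 1) :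
    (-Real.log b) ^ α / Real.Gamma (α + 1) ≤ ∫ t, rampInv a b t ∂expGamma α := by
  have hb : 0 < b := ha.trans hab
  have hy : 0 < -Real.log b := by linarith [Real.log_neg hb hb1]
  have hlog := Real.log_lt_log ha hab
  obtain ⟨h1, h2⟩ := integral_rampInv_aux (b := b) hα ha (hab.trans hb1) hab
  rw [h2, ← setIntegral_rpow hα hy]
  have hG := Real.Gamma_pos_of_pos hα
  calc ∫ x in Set.Ioc 0 (-Real.log b), (Real.Gamma α)⁻¹ * x ^ (α - 1)
      = ∫ x in Set.Ioc 0 (-Real.log b), (Real.Gamma α)⁻¹ * (x ^ (α - 1)) *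
          (Real.exp (-x) * rampInv a b (Real.exp (-x))) := by
        refine setIntegral_congr_fun measurableSet_Ioc fun x hx => ?_
        rw [mul_rampInv_of_ge ha hab, mul_one]
        rw [← Real.exp_log hb]
        exact Real.exp_le_exp.2 (by linarith [hx.2])
    _ ≤ _ := by
        refine setIntegral_mono_set h1 ?_ ?_
        · filter_upwards [ae_restrict_mem measurableSet_Ioc] with x hx
          have hx0 : 0 < x := hx.1
          have e0 : 0 ≤ Real.exp (-x) * rampInv a b (Real.exp (-x)) :=
            mul_nonneg (Real.exp_pos _).le (rampInv_nonneg ha _)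
          simp only [Pi.zero_apply]
          positivity
        · exact (Set.Ioc_subset_Ioc_right (by linarith)).eventuallyLE

/-- Karamata's Tauberian theorem for a sequence of nonnegative sequences. -/
theorem tendsto_sum_of_tendsto_laplace {α : ℝ} (hα : 0 < α) {a : ℕ → ℕ → ℝ} {m : ℕ → ℕ}
    {d : ℕ → ℝ} (ha : ∀ n i, 0 ≤ a n i) (hm : ∀ n, 0 < m n) (hd : ∀ n, 0 ≤ d n)
    (hs : ∀ n, Summable fun i => Real.exp (-((1 : ℕ) / (m n : ℝ))) ^ i * a n i)
    (hlap : ∀ k : ℕ, 0 < k → Tendsto (fun n => d n *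
      ∑' i, Real.exp (-((k : ℝ) / m n)) ^ i * a n i) atTop (𝓝 ((k : ℝ) ^ (-α)))) :
    Tendsto (fun n => d n * ∑ i ∈ Finset.range (m n + 1), a n i) atTop
      (𝓝 (1 / Real.Gamma (α + 1))) := by
  set t : ℕ → ℕ → ℝ := fun n i => Real.exp (-((1 : ℕ) / (m n : ℝ))) ^ i with ht
  have ht0 : ∀ n i, 0 < t n i := fun n i => pow_pos (Real.exp_pos _) i
  have ht1 : ∀ n i, t n i ≤ 1 := fun n i =>
    pow_le_one₀ (Real.exp_pos _).le (Real.exp_le_one_iff.2 (by simp))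
  have hte : ∀ n i, t n i = Real.exp (-(i / m n)) := fun n i => by
    simp only [ht]
    rw [← Real.exp_nat_mul]
    congr 1
    push_cast
    ring
  set c : ℕ → ℕ → ℝ≥0∞ := fun n i => ENNReal.ofReal (d n * (t n i * a n i)) with hc
  have hcr : ∀ n i, (c n i).toReal = d n * (t n i * a n i) := fun n i =>
    ENNReal.toReal_ofReal (mul_nonneg (hd n) (mul_nonneg (ht0 n i).le (ha n i)))
  -- Atoms at t = e^{-i/m} with mass d · t · a. The k-th moment of this measure is the normalised
  -- Laplace sum at k + 1, and integrating (1/t)·1_{t ≥ e^{-1}} recovers the normalised partial sum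
  -- up to m.
  set σ : ℕ → Measure ℝ := fun n => Measure.sum fun i => c n i • Measure.dirac (t n i) with hσ
  have hσint : ∀ n (g : ℝ → ℝ), ∫ x, g x ∂σ n = ∑' i, d n * (t n i * a n i) * g (t n i) := by
    intro n g
    rw [hσ, integral_sum_dirac fun i => ENNReal.ofReal_ne_top]
    exact tsum_congr fun i => congrArg (· * g (t n i)) (hcr n i)
  have hsc : ∀ n, Summable fun i => d n * (t n i * a n i) := fun n => (hs n).mul_left _
  have hfin : ∀ n, IsFiniteMeasure (σ n) := fun n => ⟨by
    rw [hσ, Measure.sum_apply _ MeasurableSet.univ]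
    simp only [Measure.smul_apply, measure_univ, smul_eq_mul, mul_one]
    exact lt_top_iff_ne_top.2 (hsc n).tsum_ofReal_ne_top⟩
  have hmem : ∀ n, ∀ᵐ x ∂σ n, x ∈ Set.Icc (0 : ℝ) 1 := fun n => by
    refine (Measure.ae_sum_iff' (p := fun x => x ∈ Set.Icc (0 : ℝ) 1) measurableSet_Icc).2
      fun i => Measure.ae_smul_measure ?_ _
    exact (ae_dirac_iff (p := fun x => x ∈ Set.Icc (0 : ℝ) 1) measurableSet_Icc).2 ⟨(ht0 n i).le, ht1 n i⟩
  have := isProbabilityMeasure_expGamma hα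
  have hconv : ∀ g : ℝ → ℝ, Continuous g → Tendsto (fun n => ∫ x, g x ∂σ n) atTop
      (𝓝 (∫ x, g x ∂expGamma α)) := fun g hg => by
    refine tendsto_integral_of_tendsto_moments hmem expGamma_ae_mem (fun k => ?_) hg
    rw [expGamma_moment hα]
    refine (hlap (k + 1) k.succ_pos).congr fun n => ?_
    rw [hσint, ← tsum_mul_left]
    refine tsum_congr fun i => ?_
    have : Real.exp (-(((k + 1 : ℕ) : ℝ) / m n)) ^ i = t n i * t n i ^ k := by
      rw [hte, ← Real.exp_nat_mul, ← Real.exp_nat_mul, ← Real.exp_add]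
      congr 1
      push_cast
      ring
    rw [this]
    ring
  have hsum : ∀ n (g : ℝ → ℝ), Continuous g → Summable fun i => d n * (t n i * a n i) * g (t n i) := by
    intro n g hg
    obtain ⟨C, hC⟩ := isCompact_Icc.exists_bound_of_continuousOn (s := Set.Icc (0 : ℝ) 1)
      hg.continuousOn
    refine Summable.of_norm_bounded ((hsc n).mul_right C) fun i => ?_
    rw [norm_mul, Real.norm_of_nonneg (mul_nonneg (hd n) (mul_nonneg (ht0 n i).le (ha n i)))]
    gcongr
    · exact mul_nonneg (hd n) (mul_nonneg (ht0 n i).le (ha n i))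
    · exact hC _ ⟨(ht0 n i).le, ht1 n i⟩
  have hle_iff : ∀ n i, i ∈ Finset.range (m n + 1) ↔ Real.exp (-1) ≤ t n i := by
    intro n i
    have : (0 : ℝ) < m n := Nat.cast_pos.2 (hm n)
    rw [Finset.mem_range, Nat.lt_succ_iff, hte, Real.exp_le_exp, neg_le_neg_iff, div_le_one this,
      Nat.cast_le]
  -- The discontinuous cutoff at e^{-1} is bounded above by a ramp from e^{-x} to e^{-1} with x > 1,
  -- and below by one from e^{-1} to e^{-x} with x < 1; then x tends to 1.
  have hupper : ∀ x : ℝ, 1 < x → ∀ n, d n * ∑ i ∈ Finset.range (m n + 1), a n i ≤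
      ∫ s, rampInv (Real.exp (-x)) (Real.exp (-1)) s ∂σ n := by
    intro x hx n
    have hlt : Real.exp (-x) < Real.exp (-1) := Real.exp_lt_exp.2 (by linarith)
    rw [hσint, Finset.mul_sum]
    refine le_trans (Finset.sum_le_sum fun i hi => ?_) ((hsum n _ (continuous_rampInv
      (Real.exp_pos _))).sum_le_tsum (Finset.range (m n + 1)) fun i _ =>
        mul_nonneg (mul_nonneg (hd n) (mul_nonneg (ht0 n i).le (ha n i)))
          (rampInv_nonneg (Real.exp_pos _) _))
    have h1 := mul_rampInv_of_ge (Real.exp_pos _) hlt ((hle_iff n i).1 hi)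
    refine le_of_eq ?_
    linear_combination (- (d n * a n i)) * h1
  have hlower : ∀ x : ℝ, x < 1 → ∀ n, ∫ s, rampInv (Real.exp (-1)) (Real.exp (-x)) s ∂σ n ≤
      d n * ∑ i ∈ Finset.range (m n + 1), a n i := by
    intro x hx n
    have hlt : Real.exp (-1) < Real.exp (-x) := Real.exp_lt_exp.2 (by linarith)
    rw [hσint, Finset.mul_sum, tsum_eq_sum (s := Finset.range (m n + 1))]
    · refine Finset.sum_le_sum fun i _ => ?_
      have h1 := mul_rampInv_le_one (b := Real.exp (-x)) (Real.exp_pos (-1)) (ht0 n i).le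
      have h2 := mul_le_mul_of_nonneg_left h1 (mul_nonneg (hd n) (ha n i))
      linarith
    · intro i hi
      rw [hle_iff, not_le] at hi
      rw [rampInv_of_le hlt hi.le, mul_zero]
  have hG := Real.Gamma_pos_of_pos (show 0 < α + 1 by linarith)
  have hcont : ContinuousAt (fun x : ℝ => x ^ α / Real.Gamma (α + 1)) 1 :=
    (Real.continuousAt_rpow_const _ _ (Or.inl one_ne_zero)).div_const _
  have hlim1 : Tendsto (fun x : ℝ => x ^ α / Real.Gamma (α + 1)) (𝓝 1)
      (𝓝 (1 / Real.Gamma (α + 1))) := by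
    simpa [ContinuousAt] using hcont
  refine tendsto_order.2 ⟨fun y hy => ?_, fun y hy => ?_⟩
  · obtain ⟨x, ⟨hx, hx1⟩, hx0⟩ := ((((hlim1.mono_left nhdsWithin_le_nhds).eventually
      (lt_mem_nhds hy)).and (self_mem_nhdsWithin (s := Set.Iio (1 : ℝ)))).and
      (nhdsWithin_le_nhds (lt_mem_nhds (zero_lt_one' ℝ)))).exists
    have hx1 : x < 1 := hx1
    have hx0 : 0 < x := hx0
    have h1 := le_integral_rampInv hα (Real.exp_pos (-1))
      (Real.exp_lt_exp.2 (by linarith : (-1 : ℝ) < -x)) (Real.exp_lt_one_iff.2 (by linarith))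
    rw [Real.log_exp, neg_neg] at h1
    filter_upwards [(hconv _ (continuous_rampInv (b := Real.exp (-x))
      (Real.exp_pos (-1)))).eventually (lt_mem_nhds (hx.trans_le h1))] with n hn
    exact hn.trans_le (hlower x hx1 n)
  · obtain ⟨x, hx, hx1⟩ := (((hlim1.mono_left nhdsWithin_le_nhds).eventually
      (gt_mem_nhds hy)).and (self_mem_nhdsWithin (s := Set.Ioi (1 : ℝ)))).exists
    have hx1 : 1 < x := hx1
    have h1 := integral_rampInv_le hα (Real.exp_pos (-x)) (Real.exp_lt_one_iff.2 (by linarith))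
      (Real.exp_lt_exp.2 (by linarith : -x < -1))
    rw [Real.log_exp, neg_neg] at h1
    filter_upwards [(hconv _ (continuous_rampInv (b := Real.exp (-1))
      (Real.exp_pos (-x)))).eventually (gt_mem_nhds (h1.trans_lt hx))] with n hn
    exact (hupper x hx1 n).trans_lt hn

end InfiniteErgodic

/-! ### Local uniformity of slow variation -/

namespace InfiniteErgodic

/-- Convergence of differences at fixed shifts implies convergence at vanishing shifts. -/
lemma tendsto_sub_of_measurable {h : ℝ → ℝ} (hmeas : Measurable h)
    (hh : ∀ u, Tendsto (fun x => h (x + u) - h x) atTop (𝓝 0))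
    {x u : ℕ → ℝ} (hx : Tendsto x atTop atTop) (hu : Tendsto u atTop (𝓝 0)) :
    Tendsto (fun n => h (x n + u n) - h (x n)) atTop (𝓝 0) := by
  -- Measurability enters here: truncation at 1 permits dominated convergence, so differences over
  -- fixed shifts vanish on average over a bounded window, along any sequence tending to infinity.
  have key : ∀ v : ℕ → ℝ, Tendsto v atTop atTop → Tendsto (fun n =>
      ∫ s in Set.Icc (0 : ℝ) 3, min 1 |h (v n + s) - h (v n)|) atTop (𝓝 0) := by
    intro v hv
    have h0 : ∫ _ in Set.Icc (0 : ℝ) 3, (0 : ℝ) = 0 := integral_zero _ _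
    suffices h1 : Tendsto (fun n => ∫ s in Set.Icc (0 : ℝ) 3, min 1 |h (v n + s) - h (v n)|) atTop
        (𝓝 (∫ _ in Set.Icc (0 : ℝ) 3, (0 : ℝ))) by rwa [h0] at h1
    refine tendsto_integral_of_dominated_convergence (fun _ => 1) (fun n => ?_)
      (integrable_const _) ?_ ?_
    · exact Measurable.aestronglyMeasurable (by fun_prop)
    · intro n
      refine Eventually.of_forall fun s => ?_
      rw [Real.norm_of_nonneg (le_min zero_le_one (abs_nonneg _))]
      exact min_le_left _ _
    · refine Eventually.of_forall fun s => ?_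
      have := (tendsto_const_nhds (x := (1 : ℝ))).min ((hh s).comp hv).abs
      simpa using this
  have hxu : Tendsto (fun n => x n + u n) atTop atTop := hx.atTop_add hu
  have hsum := (key _ hx).add (key _ hxu)
  rw [add_zero] at hsum
  have hmin : Tendsto (fun n => min 1 |h (x n + u n) - h (x n)|) atTop (𝓝 0) := by
    refine squeeze_zero' (Eventually.of_forall fun n => le_min zero_le_one (abs_nonneg _)) ?_ hsum
    have hu1 : ∀ᶠ n in atTop, |u n| < 1 := by
      have := hu.abs
      rw [abs_zero] at this
      exact this.eventually (gt_mem_nhds one_pos)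
    filter_upwards [hu1] with n hn
    rw [abs_lt] at hn
    set F : ℝ → ℝ := fun s => min 1 |h (x n + s) - h (x n)| with hF
    set G : ℝ → ℝ := fun s => min 1 |h (x n + u n + s) - h (x n + u n)| with hG
    have hFm : Measurable F := by fun_prop
    have hGm : Measurable G := by fun_prop
    have hF0 : ∀ s, 0 ≤ F s := fun s => le_min zero_le_one (abs_nonneg _)
    have hG0 : ∀ s, 0 ≤ G s := fun s => le_min zero_le_one (abs_nonneg _)
    have hint : ∀ (φ : ℝ → ℝ) (a b : ℝ), Measurable φ → (∀ s, 0 ≤ φ s) → (∀ s, φ s ≤ 1) →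
        IntegrableOn φ (Set.Icc a b) := by
      intro φ a b hφ h0 h1
      refine Integrable.of_bound hφ.aestronglyMeasurable 1 (Eventually.of_forall fun s => ?_)
      rw [Real.norm_of_nonneg (h0 s)]
      exact h1 s
    -- Any third point x + s can serve as a pivot, reached from x by the shift s and from x + u by
    -- the shift s - u. Averaging over s in [1, 2] keeps both shifts in [0, 3] because |u| < 1.
    have hpt : ∀ s, min 1 |h (x n + u n) - h (x n)| ≤ F s + G (s - u n) := by
      intro s
      simp only [hF, hG]
      have e : x n + u n + (s - u n) = x n + s := by ring
      rw [e]
      have tri : |h (x n + u n) - h (x n)| ≤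
          |h (x n + s) - h (x n)| + |h (x n + s) - h (x n + u n)| := by
        have := abs_sub (h (x n + s) - h (x n)) (h (x n + s) - h (x n + u n))
        simpa using this
      rcases le_total 1 |h (x n + s) - h (x n)| with h1 | h1
      · rw [min_eq_left h1]
        linarith [min_le_left 1 |h (x n + u n) - h (x n)|,
          le_min zero_le_one (abs_nonneg (h (x n + s) - h (x n + u n)))]
      rcases le_total 1 |h (x n + s) - h (x n + u n)| with h2 | h2
      · rw [min_eq_left h2]
        linarith [min_le_left 1 |h (x n + u n) - h (x n)|,
          le_min zero_le_one (abs_nonneg (h (x n + s) - h (x n)))]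
      rw [min_eq_right h1, min_eq_right h2]
      exact (min_le_right _ _).trans tri
    have hI1 : ∫ s in Set.Icc (1 : ℝ) 2, F s ≤ ∫ s in Set.Icc (0 : ℝ) 3, F s :=
      setIntegral_mono_set (hint F 0 3 hFm hF0 fun s => min_le_left _ _)
        (Eventually.of_forall hF0) (Set.Icc_subset_Icc (by norm_num) (by norm_num)).eventuallyLE
    have hI2 : ∫ s in Set.Icc (1 : ℝ) 2, G (s - u n) ≤ ∫ s in Set.Icc (0 : ℝ) 3, G s := by
      have e : ∫ s in Set.Icc (1 : ℝ) 2, G (s - u n) =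
          ∫ s in Set.Icc (1 - u n) (2 - u n), G s := by
        rw [integral_Icc_eq_integral_Ioc, integral_Icc_eq_integral_Ioc,
          ← intervalIntegral.integral_of_le (by norm_num),
          ← intervalIntegral.integral_of_le (by linarith),
          intervalIntegral.integral_comp_sub_right (fun s => G s)]
      rw [e]
      exact setIntegral_mono_set (hint G 0 3 hGm hG0 fun s => min_le_left _ _)
        (Eventually.of_forall hG0)
        (Set.Icc_subset_Icc (by linarith) (by linarith)).eventuallyLE
    have hGu : IntegrableOn (fun s => G (s - u n)) (Set.Icc 1 2) :=
      hint _ _ _ (hGm.comp (measurable_id.sub_const _)) (fun s => hG0 _)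
        fun s => min_le_left _ _
    have hF12 := hint F 1 2 hFm hF0 fun s => min_le_left _ _
    calc min 1 |h (x n + u n) - h (x n)|
        = ∫ s in Set.Icc (1 : ℝ) 2, min 1 |h (x n + u n) - h (x n)| := by
          rw [setIntegral_const, measureReal_def, Real.volume_Icc]
          norm_num
      _ ≤ ∫ s in Set.Icc (1 : ℝ) 2, (F s + G (s - u n)) :=
          integral_mono (by simp) (hF12.add hGu) hpt
      _ = (∫ s in Set.Icc (1 : ℝ) 2, F s) + ∫ s in Set.Icc (1 : ℝ) 2, G (s - u n) :=
          integral_add hF12 hGu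
      _ ≤ _ := add_le_add hI1 hI2
  rw [tendsto_zero_iff_abs_tendsto_zero]
  refine hmin.congr' ?_
  filter_upwards [hmin.eventually (gt_mem_nhds one_pos)] with n hn
  rcases min_lt_iff.1 hn with h1 | h1
  · exact absurd h1 (lt_irrefl _)
  · exact min_eq_right h1.le

/-- Local uniformity in the definition of slow variation. -/
lemma IsSlowlyVarying.tendsto_div {l : ℝ → ℝ} (hl : IsSlowlyVarying l) {x y : ℕ → ℝ}
    (hx : Tendsto x atTop atTop) (hy : ∀ᶠ n in atTop, 0 < y n)
    (hxy : Tendsto (fun n => y n / x n) atTop (𝓝 1)) :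
    Tendsto (fun n => l (y n) / l (x n)) atTop (𝓝 1) := by
  have hlexp : Measurable fun s : ℝ => l (Real.exp s) :=
    hl.measurable.comp (Real.measurable_exp.subtype_mk (h := fun s => Real.exp_pos s))
  have hmeas : Measurable fun s : ℝ => Real.log (l (Real.exp s)) :=
    Real.measurable_log.comp hlexp
  have hh : ∀ u, Tendsto (fun s => Real.log (l (Real.exp (s + u))) - Real.log (l (Real.exp s)))
      atTop (𝓝 0) := by
    intro u
    have h1 := ((hl.tendsto (Real.exp u) (Real.exp_pos u)).comp Real.tendsto_exp_atTop).log
      one_ne_zero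
    rw [Real.log_one] at h1
    refine h1.congr fun s => ?_
    simp only [Function.comp]
    rw [Real.log_div (hl.pos _ (by positivity)).ne' (hl.pos _ (Real.exp_pos s)).ne', mul_comm,
      ← Real.exp_add]
  have hlog := hxy.log one_ne_zero
  rw [Real.log_one] at hlog
  have h2 := tendsto_sub_of_measurable hmeas hh (Real.tendsto_log_atTop.comp hx) hlog
  have h3 := (Real.continuous_exp.tendsto 0).comp h2
  rw [Real.exp_zero] at h3
  refine h3.congr' ?_
  filter_upwards [hy, hx.eventually_gt_atTop 0] with n hy hx
  simp only [Function.comp]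
  rw [Real.log_div hy.ne' hx.ne', add_sub_cancel, Real.exp_log hy, Real.exp_log hx, Real.exp_sub,
    Real.exp_log (hl.pos _ hy), Real.exp_log (hl.pos _ hx)]

/-! ### Generating functions of an approximate renewal equation -/

lemma tsum_tsum_eq_tsum_antidiagonal (f : ℕ → ℕ → ℝ≥0∞) :
    ∑' i, ∑' j, f i j = ∑' n, ∑ p ∈ Finset.HasAntidiagonal.antidiagonal n, f p.1 p.2 := by
  rw [← ENNReal.tsum_prod, ← Finset.HasAntidiagonal.sigmaAntidiagonalEquivProd.tsum_eq,
    ENNReal.tsum_sigma']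
  refine tsum_congr fun n => ?_
  rw [tsum_fintype]
  exact Finset.sum_coe_sort (Finset.HasAntidiagonal.antidiagonal n) fun p => f p.1 p.2

lemma tsum_pow_mul_sum_range (z : ℝ≥0∞) (c : ℕ → ℝ≥0∞) :
    ∑' n, z ^ n * ∑ j ∈ Finset.range (n + 1), c j = (1 - z)⁻¹ * ∑' j, z ^ j * c j := by
  rw [← ENNReal.tsum_geometric, ← ENNReal.tsum_mul_right]
  simp_rw [← ENNReal.tsum_mul_left]
  rw [tsum_tsum_eq_tsum_antidiagonal, tsum_congr]
  intro n
  rw [← Finset.sum_range_reflect, Finset.Nat.sum_antidiagonal_eq_sum_range_succ_mk, Finset.mul_sum]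
  refine Finset.sum_congr rfl fun i hi => ?_
  have hi : i ≤ n := Nat.lt_succ_iff.1 (Finset.mem_range.1 hi)
  rw [← mul_assoc, ← pow_add, Nat.add_sub_cancel' hi]
  congr 2

section Renewal

variable {z e ε D : ℝ≥0∞} {b : ℕ → ℕ → ℝ≥0∞} {w a y : ℕ → ℝ≥0∞}

/-- One factor (1-z)⁻¹ comes from the partial sums in j, the other from the antidiagonal sums in j +
i, all of which equal e. -/
lemma renewal_double_sum (hb : ∀ t, ∑ p ∈ Finset.HasAntidiagonal.antidiagonal t, b p.1 p.2 = e) :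
    ∑' i, z ^ i * ∑' n, z ^ n * ∑ j ∈ Finset.range (n + 1), b j i =
      (1 - z)⁻¹ * ((1 - z)⁻¹ * e) := by
  simp_rw [tsum_pow_mul_sum_range]
  have h1 : ∀ i, z ^ i * ((1 - z)⁻¹ * ∑' j, z ^ j * b j i) =
      (1 - z)⁻¹ * ∑' j, z ^ (j + i) * b j i := by
    intro i
    rw [mul_left_comm, ← ENNReal.tsum_mul_left]
    congr 1
    refine tsum_congr fun j => ?_
    rw [pow_add]
    ring
  simp_rw [h1]
  rw [ENNReal.tsum_mul_left, ENNReal.tsum_comm, tsum_tsum_eq_tsum_antidiagonal,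
    ← ENNReal.tsum_geometric, ← ENNReal.tsum_mul_right (a := e)]
  congr 1
  refine tsum_congr fun n => ?_
  rw [← hb n, Finset.mul_sum]
  refine Finset.sum_congr rfl fun p hp => ?_
  rw [Finset.HasAntidiagonal.mem_antidiagonal.1 hp]

lemma renewal_weight_sum (c : ℕ → ℝ≥0∞) :
    ∑' i, z ^ i * ∑' n, z ^ n * ((ε * w (n + 1) + D) * c i) =
      (ε * (∑' n, z ^ n * w (n + 1)) + D * (1 - z)⁻¹) * ∑' i, z ^ i * c i := by
  rw [← ENNReal.tsum_geometric, ← ENNReal.tsum_mul_left (a := ε), ← ENNReal.tsum_mul_left (a := D),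
    ← ENNReal.tsum_add, ← ENNReal.tsum_mul_left]
  refine tsum_congr fun i => ?_
  rw [← mul_assoc, mul_comm _ (z ^ i), mul_assoc, ← ENNReal.tsum_mul_right]
  congr 1
  refine tsum_congr fun n => ?_
  ring

lemma renewal_upper (hb : ∀ t, ∑ p ∈ Finset.HasAntidiagonal.antidiagonal t, b p.1 p.2 = e)
    (h : ∀ n i, ∑ j ∈ Finset.range (n + 1), b j i ≤
      w (n + 1) * a i + (ε * w (n + 1) + D) * y i) :
    (1 - z)⁻¹ * ((1 - z)⁻¹ * e) ≤ (∑' n, z ^ n * w (n + 1)) * (∑' i, z ^ i * a i) +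
      (ε * (∑' n, z ^ n * w (n + 1)) + D * (1 - z)⁻¹) * ∑' i, z ^ i * y i := by
  have h1 := renewal_weight_sum (z := z) (ε := 1) (D := 0) (w := w) a
  simp only [one_mul, add_zero, zero_mul] at h1
  rw [← renewal_double_sum hb, ← renewal_weight_sum y, ← h1, ← ENNReal.tsum_add]
  refine ENNReal.tsum_le_tsum fun i => ?_
  rw [← mul_add, ← ENNReal.tsum_add]
  gcongr with n
  rw [← mul_add]
  gcongr
  exact h n i

lemma renewal_lower (hb : ∀ t, ∑ p ∈ Finset.HasAntidiagonal.antidiagonal t, b p.1 p.2 = e)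
    (h : ∀ n i, w (n + 1) * a i ≤
      ∑ j ∈ Finset.range (n + 1), b j i + (ε * w (n + 1) + D) * y i) :
    (∑' n, z ^ n * w (n + 1)) * (∑' i, z ^ i * a i) ≤ (1 - z)⁻¹ * ((1 - z)⁻¹ * e) +
      (ε * (∑' n, z ^ n * w (n + 1)) + D * (1 - z)⁻¹) * ∑' i, z ^ i * y i := by
  have h1 := renewal_weight_sum (z := z) (ε := 1) (D := 0) (w := w) a
  simp only [one_mul, add_zero, zero_mul] at h1
  rw [← renewal_double_sum hb, ← renewal_weight_sum y, ← h1, ← ENNReal.tsum_add]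
  refine ENNReal.tsum_le_tsum fun i => ?_
  rw [← mul_add, ← ENNReal.tsum_add]
  gcongr with n
  rw [← mul_add]
  gcongr
  exact h n i

/-- Shifting the index by r ≤ K costs at most a factor z^{-K}, harmless as z → 1. Hence the error
sequence y is controlled by a itself. -/
lemma sweeping_laplace {C : ℝ≥0∞} {K : ℕ} (hz : z ≤ 1)
    (h : ∀ i, y i ≤ C * ∑ r ∈ Finset.range (K + 1), a (i + r)) :
    z ^ K * ∑' i, z ^ i * y i ≤ C * (K + 1) * ∑' i, z ^ i * a i := by
  have h1 : ∀ i, z ^ K * (z ^ i * y i) ≤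
      C * ∑ r ∈ Finset.range (K + 1), z ^ (i + r) * a (i + r) := by
    intro i
    calc z ^ K * (z ^ i * y i)
        ≤ z ^ K * (z ^ i * (C * ∑ r ∈ Finset.range (K + 1), a (i + r))) := by
          gcongr
          exact h i
      _ = C * ∑ r ∈ Finset.range (K + 1), z ^ (i + K) * a (i + r) := by
          rw [← Finset.mul_sum, pow_add]
          ring
      _ ≤ _ := by
          gcongr C * ?_
          refine Finset.sum_le_sum fun r hr => ?_
          have : r ≤ K := Nat.lt_succ_iff.1 (Finset.mem_range.1 hr)
          exact mul_le_mul_left (pow_le_pow_right_of_le_one' hz (by omega)) _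
  rw [← ENNReal.tsum_mul_left]
  refine (ENNReal.tsum_le_tsum h1).trans ?_
  rw [ENNReal.tsum_mul_left, Summable.tsum_finsetSum fun _ _ => ENNReal.summable, mul_assoc]
  gcongr C * ?_
  refine (Finset.sum_le_card_nsmul _ _ (∑' i, z ^ i * a i) fun r _ => ?_).trans ?_
  · exact ENNReal.tsum_comp_le_tsum_of_injective (add_left_injective r) fun i => z ^ i * a i
  · simp

end Renewal
end InfiniteErgodic

/-! ### From approximate renewal to partial sums -/

namespace InfiniteErgodic

lemma tendsto_one_of_abs_le {ι : Type*} {f : Filter ι} {x : ι → ℝ} (hx : ∀ i, 0 ≤ x i)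
    (h : ∀ ε : ℝ, 0 < ε → ∀ᶠ i in f, |1 - x i| ≤ ε * x i) : Tendsto x f (𝓝 1) := by
  rw [Metric.tendsto_nhds]
  intro δ hδ
  -- The bound with 1/2 gives x ≤ 2, after which the bound with δ/3 gives at most 2δ/3.
  filter_upwards [h (min (1 / 2) (δ / 3)) (by positivity)] with i hi
  have h1 : |1 - x i| ≤ 1 / 2 * x i :=
    hi.trans (mul_le_mul_of_nonneg_right (min_le_left _ _) (hx i))
  have h2 : |1 - x i| ≤ δ / 3 * x i :=
    hi.trans (mul_le_mul_of_nonneg_right (min_le_right _ _) (hx i))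
  have h3 := (abs_le.1 h1).1
  rw [dist_comm, Real.dist_eq]
  nlinarith

lemma toReal_tsum_pow_mul {z : ℝ} (hz : 0 ≤ z) {c : ℕ → ℝ≥0∞} (hc : ∀ i, c i ≠ ∞) :
    (∑' i, ENNReal.ofReal z ^ i * c i).toReal = ∑' i, z ^ i * (c i).toReal := by
  rw [ENNReal.tsum_toReal_eq fun i => ENNReal.mul_ne_top (by finiteness) (hc i)]
  simp [ENNReal.toReal_ofReal hz]

lemma tsum_pow_mul_ne_top {z : ℝ} (hz1 : z < 1) {c : ℕ → ℝ≥0∞} {M : ℝ≥0}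
    (hc : ∀ i, c i ≤ M) : ∑' i, ENNReal.ofReal z ^ i * c i ≠ ∞ := by
  refine ne_top_of_le_ne_top ?_ (ENNReal.tsum_le_tsum fun i => mul_le_mul_right (hc i) _)
  rw [ENNReal.tsum_mul_right, ENNReal.tsum_geometric]
  refine ENNReal.mul_ne_top (ENNReal.inv_ne_top.2 ?_) ENNReal.coe_ne_top
  rw [← ENNReal.ofReal_one]
  exact (tsub_pos_of_lt ((ENNReal.ofReal_lt_ofReal_iff one_pos).2 hz1)).ne'

lemma summable_pow_mul_toReal {z : ℝ} (hz : 0 ≤ z) (hz1 : z < 1) {c : ℕ → ℝ≥0∞} {M : ℝ≥0}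
    (hc : ∀ i, c i ≤ M) : Summable fun i => z ^ i * (c i).toReal := by
  have h := ENNReal.summable_toReal (tsum_pow_mul_ne_top hz1 hc)
  refine h.congr fun i => ?_
  simp [ENNReal.toReal_ofReal hz]

/-- The two renewal inequalities combined with sweeping, in real numbers. The right-hand side is
proportional to the generating function of `a`, so no a priori estimate of its size is required. -/
lemma abs_sub_laplace_le {w : ℕ → ℝ} {β : ℝ} (h : ConcaveRegVar w β)
    {a y : ℕ → ℝ≥0∞} {b : ℕ → ℕ → ℝ≥0∞} {e : ℝ≥0∞} {C M ε D : ℝ≥0} {K : ℕ}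
    (heT : e ≠ ∞) (ha : ∀ i, a i ≤ M)
    (hb : ∀ t, ∑ p ∈ Finset.HasAntidiagonal.antidiagonal t, b p.1 p.2 = e)
    (hup : ∀ n i, ∑ j ∈ Finset.range (n + 1), b j i ≤
      ENNReal.ofReal (w (n + 1)) * a i + (ε * ENNReal.ofReal (w (n + 1)) + D) * y i)
    (hlo : ∀ n i, ENNReal.ofReal (w (n + 1)) * a i ≤
      ∑ j ∈ Finset.range (n + 1), b j i + (ε * ENNReal.ofReal (w (n + 1)) + D) * y i)
    (hy : ∀ i, y i ≤ C * ∑ r ∈ Finset.range (K + 1), a (i + r))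
    {z : ℝ} (hz : 0 < z) (hz1 : z < 1) :
    |(1 - z)⁻¹ * ((1 - z)⁻¹ * e.toReal) -
      (∑' n, z ^ n * w (n + 1)) * ∑' i, z ^ i * (a i).toReal| ≤
      (ε * (∑' n, z ^ n * w (n + 1)) + D * (1 - z)⁻¹) *
        (C * (K + 1) * (∑' i, z ^ i * (a i).toReal) / z ^ K) := by
  set Z := ENNReal.ofReal z with hZ
  have hyM : ∀ i, y i ≤ (C * ((K + 1 : ℕ) * M) : ℝ≥0) := fun i => by
    refine (hy i).trans ?_
    push_cast
    gcongr
    refine (Finset.sum_le_card_nsmul _ _ _ fun r _ => ha (i + r)).trans ?_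
    simp
  have hAT : ∑' i, Z ^ i * a i ≠ ∞ := tsum_pow_mul_ne_top hz1 ha
  have hYT : ∑' i, Z ^ i * y i ≠ ∞ := tsum_pow_mul_ne_top hz1 hyM
  have hZ1 : Z < 1 := by
    rw [hZ, ← ENNReal.ofReal_one]
    exact (ENNReal.ofReal_lt_ofReal_iff one_pos).2 hz1
  have hgT : (1 - Z)⁻¹ ≠ ∞ := ENNReal.inv_ne_top.2 (tsub_pos_of_lt hZ1).ne'
  have hg : ((1 - Z)⁻¹).toReal = (1 - z)⁻¹ := by
    rw [ENNReal.toReal_inv, ENNReal.toReal_sub_of_le hZ1.le ENNReal.one_ne_top,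
      ENNReal.toReal_one, ENNReal.toReal_ofReal hz.le]
  have hVT : ∑' n, Z ^ n * ENNReal.ofReal (w (n + 1)) ≠ ∞ := by
    have := (h.summable_pow_mul hz.le hz1).tsum_ofReal_ne_top
    refine (tsum_congr fun n => ?_).trans_ne this
    rw [ENNReal.ofReal_mul (by positivity), ENNReal.ofReal_pow hz.le]
  have hV : (∑' n, Z ^ n * ENNReal.ofReal (w (n + 1))).toReal = ∑' n, z ^ n * w (n + 1) := by
    rw [toReal_tsum_pow_mul hz.le fun _ => ENNReal.ofReal_ne_top]
    exact tsum_congr fun n => by rw [ENNReal.toReal_ofReal (h.nonneg _)]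
  have hA : (∑' i, Z ^ i * a i).toReal = ∑' i, z ^ i * (a i).toReal :=
    toReal_tsum_pow_mul hz.le fun i => ne_top_of_le_ne_top ENNReal.coe_ne_top (ha i)
  have r1 := renewal_upper (z := Z) hb (w := fun n => ENNReal.ofReal (w n)) hup
  have r2 := renewal_lower (z := Z) hb (w := fun n => ENNReal.ofReal (w n)) hlo
  have r3 := sweeping_laplace hZ1.le hy
  have hcoef : (ε : ℝ≥0∞) * (∑' n, Z ^ n * ENNReal.ofReal (w (n + 1))) + D * (1 - Z)⁻¹ ≠ ∞ := by
    finiteness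
  have t1 := ENNReal.toReal_mono (by finiteness) r1
  have t2 := ENNReal.toReal_mono (by finiteness) r2
  have t3 := ENNReal.toReal_mono (by finiteness) r3
  rw [ENNReal.toReal_add (by finiteness) (by finiteness)] at t1 t2
  simp only [ENNReal.toReal_mul, hg, hA, hV, ENNReal.toReal_pow] at t1 t2 t3
  rw [ENNReal.toReal_add (by finiteness) (by finiteness)] at t1 t2
  simp only [ENNReal.toReal_mul, hg, hV, ENNReal.coe_toReal] at t1 t2 t3
  rw [ENNReal.toReal_add (by finiteness) (by finiteness), ENNReal.toReal_ofReal hz.le] at t3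
  simp only [ENNReal.toReal_natCast, ENNReal.toReal_one] at t3
  set V := ∑' n, z ^ n * w (n + 1)
  set A := ∑' i, z ^ i * (a i).toReal
  set Y := (∑' i, Z ^ i * y i).toReal
  have hV0 : 0 ≤ V := tsum_nonneg fun n => mul_nonneg (by positivity) (h.nonneg _)
  have hY : Y ≤ C * (K + 1) * A / z ^ K := by
    rw [le_div_iff₀ (by positivity)]
    linarith
  have hz2 : 0 < 1 - z := by linarith
  have hfin := mul_le_mul_of_nonneg_left hY (a := ε * V + D * (1 - z)⁻¹) (by positivity)
  rw [abs_le]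
  constructor <;> linarith

/-- Asymptotics of partial sums of a family of sequences satisfying an approximate renewal
equation uniformly. -/
theorem tendsto_sum_of_renewal {w : ℕ → ℝ} {β : ℝ} (h : ConcaveRegVar w β) (hβ1 : β < 1)
    {a y : ℕ → ℕ → ℝ≥0∞} {b : ℕ → ℕ → ℕ → ℝ≥0∞} {e : ℕ → ℝ≥0∞} {m : ℕ → ℕ} {C M : ℝ≥0} {K : ℕ}
    (he0 : ∀ n, e n ≠ 0) (heT : ∀ n, e n ≠ ∞) (hm : Tendsto m atTop atTop) (hm0 : ∀ n, 0 < m n)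
    (ha : ∀ n i, a n i ≤ M)
    (hb : ∀ n t, ∑ p ∈ Finset.HasAntidiagonal.antidiagonal t, b n p.1 p.2 = e n)
    (hε : ∀ ε : ℝ≥0, 0 < ε → ∃ D : ℝ≥0, ∀ n N i,
      (∑ j ∈ Finset.range (N + 1), b n j i ≤
        ENNReal.ofReal (w (N + 1)) * a n i + (ε * ENNReal.ofReal (w (N + 1)) + D) * y n i) ∧
      (ENNReal.ofReal (w (N + 1)) * a n i ≤
        ∑ j ∈ Finset.range (N + 1), b n j i + (ε * ENNReal.ofReal (w (N + 1)) + D) * y n i))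
    (hy : ∀ n i, y n i ≤ C * ∑ r ∈ Finset.range (K + 1), a n (i + r)) :
    Tendsto (fun n => w (m n) / (m n * (e n).toReal) *
      ∑ i ∈ Finset.range (m n + 1), (a n i).toReal) atTop
      (𝓝 (1 / (Real.Gamma (β + 1) * Real.Gamma (1 - β + 1)))) := by
  have hG := Real.Gamma_pos_of_pos (show 0 < β + 1 by linarith [h.index_pos])
  have hepos : ∀ n, 0 < (e n).toReal := fun n => ENNReal.toReal_pos (he0 n) (heT n)
  have hmpos : ∀ n, (0 : ℝ) < m n := fun n => Nat.cast_pos.2 (hm0 n)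
  have hlap : ∀ k : ℕ, 0 < k → Tendsto (fun n => Real.Gamma (β + 1) *
      (w (m n) / (m n * (e n).toReal)) *
        ∑' i, Real.exp (-((k : ℝ) / m n)) ^ i * (a n i).toReal) atTop
      (𝓝 ((k : ℝ) ^ (-(1 - β)))) := by
    intro k hk
    have hk' : (0 : ℝ) < k := Nat.cast_pos.2 hk
    set z : ℕ → ℝ := fun n => Real.exp (-((k : ℝ) / m n)) with hz
    have hz0 : ∀ n, 0 < z n := fun n => Real.exp_pos _
    have hz1 : ∀ n, z n < 1 := fun n => Real.exp_lt_one_iff.2 (by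
      have := hmpos n
      have : 0 < (k : ℝ) / m n := by positivity
      linarith)
    set V : ℕ → ℝ := fun n => ∑' j, z n ^ j * w (j + 1) with hV
    set A : ℕ → ℝ := fun n => ∑' i, z n ^ i * (a n i).toReal with hA
    have hA0 : ∀ n, 0 ≤ A n := fun n => tsum_nonneg fun i =>
      mul_nonneg (pow_nonneg (hz0 n).le i) ENNReal.toReal_nonneg
    have hV0 : ∀ n, 0 < V n := fun n =>
      (h.summable_pow_mul (hz0 n).le (hz1 n)).tsum_pos
        (fun i => mul_nonneg (pow_nonneg (hz0 n).le i) (h.nonneg _)) 0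
        (by simpa using h.pos 1 one_pos)
    have hW : Tendsto (fun n => (1 - z n) * V n / w (m n)) atTop
        (𝓝 ((k : ℝ) ^ (-β) * Real.Gamma (β + 1))) := (h.tendsto_laplace hk').comp hm
    -- This divergence makes the contribution of the constant D negligible, whatever its size.
    have hWtop : Tendsto (fun n => (1 - z n) * V n) atTop atTop := by
      refine ((h.tendsto_atTop.comp hm).atTop_mul_pos (by positivity) hW).congr fun n => ?_
      have := (h.pos _ (hm0 n)).ne'
      simp only [Function.comp]
      field_simp
    have hzlim : Tendsto z atTop (𝓝 1) := by
      have h1 : Tendsto (fun n => -((k : ℝ) / m n)) atTop (𝓝 0) := by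
        simpa using ((tendsto_const_div_atTop_nhds_zero_nat (k : ℝ)).comp hm).neg
      have h2 := (Real.continuous_exp.tendsto 0).comp h1
      rwa [Real.exp_zero] at h2
    -- The renewal quotient. Its distance to 1 is at most a small multiple of itself, uniformly over
    -- the family because D does not depend on n.
    set x : ℕ → ℝ := fun n => (1 - z n) ^ 2 * V n * A n / (e n).toReal with hx
    have hxlim : Tendsto x atTop (𝓝 1) := by
      refine tendsto_one_of_abs_le (fun n => ?_) fun δ hδ => ?_
      · have := hA0 n
        have := hV0 n
        have := hepos n
        simp only [hx]
        positivity
      set c : ℝ := C * (K + 1) with hc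
      have hc0 : 0 ≤ c := by positivity
      set ε : ℝ := δ / (2 * (c + 1)) with hεdef
      have hε0 : 0 < ε := by positivity
      obtain ⟨D, hD⟩ := hε ε.toNNReal (Real.toNNReal_pos.2 hε0)
      have hlimc : Tendsto (fun n => (ε + D * ((1 - z n) * V n)⁻¹) * (c / z n ^ K)) atTop
          (𝓝 ((ε + D * 0) * (c / 1 ^ K))) :=
        (tendsto_const_nhds.add (hWtop.inv_tendsto_atTop.const_mul _)).mul
          (tendsto_const_nhds.div (hzlim.pow K) (by simp))
      have hlt : (ε + D * 0) * (c / 1 ^ K) < δ := by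
        rw [mul_zero, add_zero, one_pow, div_one, hεdef, div_mul_eq_mul_div,
          div_lt_iff₀ (by positivity)]
        nlinarith
      filter_upwards [hlimc.eventually (gt_mem_nhds hlt)] with n hn
      have key := abs_sub_laplace_le h (heT n) (ha n) (hb n) (fun N i => (hD n N i).1)
        (fun N i => (hD n N i).2) (hy n) (hz0 n) (hz1 n)
      rw [Real.coe_toNNReal _ hε0.le] at key
      have hu : 0 < 1 - z n := by linarith [hz1 n]
      have e1 : 1 - x n = (1 - z n) ^ 2 / (e n).toReal *
          ((1 - z n)⁻¹ * ((1 - z n)⁻¹ * (e n).toReal) - V n * A n) := by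
        have := (hepos n).ne'
        simp only [hx]
        field_simp
      have e2 : (1 - z n) ^ 2 / (e n).toReal * ((ε * V n + D * (1 - z n)⁻¹) *
          (C * (K + 1) * A n / z n ^ K)) =
          (ε + D * ((1 - z n) * V n)⁻¹) * (c / z n ^ K) * x n := by
        have := (hepos n).ne'
        have := (hV0 n).ne'
        have := (hz0 n).ne'
        simp only [hx, hc]
        field_simp
      have hpos : 0 < (1 - z n) ^ 2 / (e n).toReal := div_pos (by positivity) (hepos n)
      rw [e1, abs_mul, abs_of_pos hpos]
      refine (mul_le_mul_of_nonneg_left key hpos.le).trans ?_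
      rw [e2]
      refine mul_le_mul_of_nonneg_right hn.le ?_
      have := hA0 n
      have := hV0 n
      have := hepos n
      simp only [hx]
      positivity
    have hmz : Tendsto (fun n => (m n : ℝ) * (1 - z n)) atTop (𝓝 k) :=
      (tendsto_mul_one_sub_exp (k : ℝ)).comp hm
    -- Dividing out the Abelian asymptotics of (1-z)V and then m(1-z) → k cancels V and both powers
    -- of 1 - z, isolating w(m) A / (m e).
    have hfin := ((hxlim.div hW (by positivity)).div hmz hk'.ne').const_mul (Real.Gamma (β + 1))
    have hval : Real.Gamma (β + 1) * (1 / ((k : ℝ) ^ (-β) * Real.Gamma (β + 1)) / k) =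
        (k : ℝ) ^ (-(1 - β)) := by
      rw [neg_sub, Real.rpow_sub hk', Real.rpow_one, Real.rpow_neg hk'.le]
      field_simp
    rw [hval] at hfin
    refine hfin.congr fun n => ?_
    have hu : 1 - z n ≠ 0 := by linarith [hz1 n]
    have := (hepos n).ne'
    have := (hV0 n).ne'
    have := (hmpos n).ne'
    have := (h.pos _ (hm0 n)).ne'
    simp only [Pi.div_apply, hx]
    field_simp
    rfl
  have hK := tendsto_sum_of_tendsto_laplace (α := 1 - β) (by linarith)
    (a := fun n i => (a n i).toReal) (m := m)
    (d := fun n => Real.Gamma (β + 1) * (w (m n) / (m n * (e n).toReal)))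
    (fun n i => ENNReal.toReal_nonneg) hm0
    (fun n => mul_nonneg hG.le (div_nonneg (h.nonneg _) (by have := hepos n; positivity)))
    (fun n => summable_pow_mul_toReal (Real.exp_pos _).le (Real.exp_lt_one_iff.2 (by
      simpa using hm0 n)) (ha n)) hlap
  have hfin := hK.const_mul (Real.Gamma (β + 1))⁻¹
  have hval : (Real.Gamma (β + 1))⁻¹ * (1 / Real.Gamma (1 - β + 1)) =
      1 / (Real.Gamma (β + 1) * Real.Gamma (1 - β + 1)) := by
    rw [one_div, one_div, mul_inv]
  rw [hval] at hfin
  refine hfin.congr fun n => ?_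
  rw [← mul_assoc, ← mul_assoc, inv_mul_cancel₀ hG.ne', one_mul]

end InfiniteErgodic

/-! ### First entrances, the wandering rate and the renewal identity -/

namespace InfiniteErgodic

section Visits

variable {X : Type*} {T : X → X} {Y : Set X}

lemma disjoint_firstEntrance {i j : ℕ} (hij : i ≠ j) :
    Disjoint (firstEntrance T Y i) (firstEntrance T Y j) := by
  wlog h : i < j generalizing i j
  · exact (this hij.symm (by omega)).symm
  refine Set.disjoint_left.2 fun x hi hj => hj.2 ?_
  exact Set.mem_biUnion (Finset.mem_coe.2 (Finset.mem_range.2 h)) hi.1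

lemma exists_mem_firstEntrance {x : X} {t : ℕ} (hx : T^[t] x ∈ Y) :
    ∃ j ≤ t, x ∈ firstEntrance T Y j := by
  classical
  have hex : ∃ j, T^[j] x ∈ Y := ⟨t, hx⟩
  refine ⟨Nat.find hex, Nat.find_le hx, Nat.find_spec hex, ?_⟩
  simp only [Set.mem_iUnion, Finset.mem_range, not_exists]
  exact fun k hk => Nat.find_min hex hk

/-- The points of `Y` that do not visit `Y` at any of the times `1, …, n`. -/
def noReturn (T : X → X) (Y : Set X) (n : ℕ) : Set X :=
  Y \ ⋃ k ∈ Finset.range n, T^[k + 1] ⁻¹' Y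

lemma mem_noReturn {n : ℕ} {x : X} :
    x ∈ noReturn T Y n ↔ x ∈ Y ∧ ∀ k < n, T^[k + 1] x ∉ Y := by
  simp [noReturn]

lemma noReturn_subset {n : ℕ} : noReturn T Y n ⊆ Y := Set.sdiff_subset

lemma noReturn_anti {m n : ℕ} (h : m ≤ n) : noReturn T Y n ⊆ noReturn T Y m := fun x hx => by
  rw [mem_noReturn] at hx ⊢
  exact ⟨hx.1, fun k hk => hx.2 k (hk.trans_le h)⟩

end Visits

variable {X : Type*} [MeasurableSpace X] {μ : Measure X} {T : X → X} {Y : Set X}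

lemma withDensity_transfer [SigmaFinite μ] (hT : MeasurePreserving T μ μ) (u : X → ℝ≥0∞) :
    μ.withDensity (transfer T μ u) = (μ.withDensity u).map T := by
  refine Measure.withDensity_rnDeriv_eq _ _ ?_
  have h := (withDensity_absolutelyContinuous μ u).map hT.measurable
  rwa [hT.map_eq] at h

lemma withDensity_transfer_iterate [SigmaFinite μ] (hT : MeasurePreserving T μ μ)
    (u : X → ℝ≥0∞) (k : ℕ) :
    μ.withDensity ((transfer T μ)^[k] u) = (μ.withDensity u).map T^[k] := by
  induction k with
  | zero => simp
  | succ k ih =>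
    rw [Function.iterate_succ_apply', withDensity_transfer hT, ih,
      Measure.map_map hT.measurable (hT.iterate k).measurable, Function.iterate_succ']

lemma setLIntegral_transfer_iterate [SigmaFinite μ] (hT : MeasurePreserving T μ μ)
    (u : X → ℝ≥0∞) (k : ℕ) {F : Set X} (hF : MeasurableSet F) :
    ∫⁻ x in F, (transfer T μ)^[k] u x ∂μ = ∫⁻ x in T^[k] ⁻¹' F, u x ∂μ := by
  rw [← withDensity_apply _ hF, withDensity_transfer_iterate hT,
    Measure.map_apply (hT.iterate k).measurable hF,
    withDensity_apply _ ((hT.iterate k).measurable hF)]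

lemma measurable_transfer_iterate {u : X → ℝ≥0∞} (hu : Measurable u) (k : ℕ) :
    Measurable ((transfer T μ)^[k] u) := by
  cases k with
  | zero => exact hu
  | succ k =>
    rw [Function.iterate_succ_apply']
    exact Measure.measurable_rnDeriv _ _

lemma measurableSet_iUnion_visit (hT : MeasurePreserving T μ μ) (hY : MeasurableSet Y) (n : ℕ) :
    MeasurableSet (⋃ k ∈ Finset.range n, T^[k] ⁻¹' Y) :=
  Finset.measurableSet_biUnion _ fun k _ => (hT.iterate k).measurable hY

lemma measurableSet_firstEntrance (hT : MeasurePreserving T μ μ) (hY : MeasurableSet Y) (n : ℕ) :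
    MeasurableSet (firstEntrance T Y n) :=
  ((hT.iterate n).measurable hY).diff (measurableSet_iUnion_visit hT hY n)

lemma measurableSet_noReturn (hT : MeasurePreserving T μ μ) (hY : MeasurableSet Y) (n : ℕ) :
    MeasurableSet (noReturn T Y n) :=
  hY.diff (Finset.measurableSet_biUnion _ fun k _ => (hT.iterate (k + 1)).measurable hY)

/-- By invariance `w n` is also the measure of the points visiting `Y` during the times 1, …, n.
Adding time 0 adds exactly the points of `Y` that do not return in that period. These sets decrease
in n, whence the concavity of `w`. -/
lemma wanderingRate_succ (hT : MeasurePreserving T μ μ) (hY : MeasurableSet Y) (n : ℕ) :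
    wanderingRate T μ Y (n + 1) = wanderingRate T μ Y n + μ (noReturn T Y n) := by
  have hm := measurableSet_iUnion_visit hT hY n
  rw [wanderingRate, wanderingRate, ← hT.measure_preimage hm.nullMeasurableSet,
    ← measure_union' _ (hT.measurable hm)]
  · congr 1
    ext x
    simp only [Set.mem_iUnion, Finset.mem_range, Set.mem_union, Set.mem_preimage, mem_noReturn]
    constructor
    · rintro ⟨k, hk, hx⟩
      by_cases h : ∃ i, ∃ (_ : i < n), T^[i] (T x) ∈ Y
      · exact Or.inl h
      · refine Or.inr ?_
        push Not at h
        cases k with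
        | zero => exact ⟨hx, fun i hi => h i hi⟩
        | succ k => exact absurd hx (h k (by omega))
    · rintro (⟨i, hi, hx⟩ | ⟨hx, -⟩)
      · exact ⟨i + 1, by omega, hx⟩
      · exact ⟨0, by omega, hx⟩
  · refine Set.disjoint_left.2 fun x hx hx' => ?_
    simp only [Set.mem_iUnion, Finset.mem_range, Set.mem_preimage] at hx
    obtain ⟨k, hk, hx⟩ := hx
    exact (mem_noReturn.1 hx').2 k hk hx

lemma wanderingRate_zero : wanderingRate T μ Y 0 = 0 := by simp [wanderingRate]

lemma wanderingRate_mono {m n : ℕ} (h : m ≤ n) :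
    wanderingRate T μ Y m ≤ wanderingRate T μ Y n :=
  measure_mono (Set.biUnion_subset_biUnion_left (by simpa using h))

lemma wanderingRate_ne_top (hT : MeasurePreserving T μ μ) (hY : MeasurableSet Y)
    (hfin : μ Y < ∞) (n : ℕ) : wanderingRate T μ Y n ≠ ∞ := by
  induction n with
  | zero => simp [wanderingRate_zero]
  | succ n ih =>
    rw [wanderingRate_succ hT hY]
    exact ENNReal.add_ne_top.2 ⟨ih, ((measure_mono noReturn_subset).trans_lt hfin).ne⟩

lemma wanderingRate_pos (hpos : 0 < μ Y) {n : ℕ} (hn : 0 < n) : 0 < wanderingRate T μ Y n := by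
  refine lt_of_lt_of_le ?_ (wanderingRate_mono (T := T) (Y := Y) hn)
  simpa [wanderingRate] using hpos

lemma toReal_wanderingRate_succ (hT : MeasurePreserving T μ μ) (hY : MeasurableSet Y)
    (hfin : μ Y < ∞) (n : ℕ) :
    (wanderingRate T μ Y (n + 1)).toReal - (wanderingRate T μ Y n).toReal =
      (μ (noReturn T Y n)).toReal := by
  rw [wanderingRate_succ hT hY, ENNReal.toReal_add (wanderingRate_ne_top hT hY hfin n)
    ((measure_mono noReturn_subset).trans_lt hfin).ne, add_sub_cancel_left]

lemma tendsto_div_of_isEquivalent {w : ℕ → ℝ} {β : ℝ} {l : ℝ → ℝ} (hl : IsSlowlyVarying l)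
    (hw : w ~[atTop] fun n : ℕ => (n : ℝ) ^ β * l n) :
    Tendsto (fun n : ℕ => w n / ((n : ℝ) ^ β * l n)) atTop (𝓝 1) := by
  refine (isEquivalent_iff_tendsto_one ?_).1 hw
  filter_upwards [eventually_gt_atTop 0] with n hn
  have hn' : (0 : ℝ) < n := Nat.cast_pos.2 hn
  have := hl.pos n hn'
  positivity

lemma concaveRegVar_wanderingRate (hT : MeasurePreserving T μ μ) (hY : MeasurableSet Y)
    (hpos : 0 < μ Y) (hfin : μ Y < ∞) {β : ℝ} (hβ : 0 < β) {l : ℝ → ℝ} (hl : IsSlowlyVarying l)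
    (hw : (fun n : ℕ => (wanderingRate T μ Y n).toReal)
      ~[atTop] fun n : ℕ => (n : ℝ) ^ β * l n) :
    ConcaveRegVar (fun n => (wanderingRate T μ Y n).toReal) β where
  zero := by simp [wanderingRate_zero]
  pos n hn := ENNReal.toReal_pos (wanderingRate_pos hpos hn).ne' (wanderingRate_ne_top hT hY hfin n)
  mono m n h := ENNReal.toReal_mono (wanderingRate_ne_top hT hY hfin n) (wanderingRate_mono h)
  anti m n h := by
    simp only [toReal_wanderingRate_succ hT hY hfin]
    exact ENNReal.toReal_mono ((measure_mono noReturn_subset).trans_lt hfin).ne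
      (measure_mono (noReturn_anti h))
  index_pos := hβ
  tendsto p hp := by
    have hp' : (0 : ℝ) < p := Nat.cast_pos.2 hp
    have h1 := tendsto_div_of_isEquivalent hl hw
    have hpn : Tendsto (fun n : ℕ => p * n) atTop atTop := tendsto_id.const_mul_atTop' hp
    have h2 := (hl.tendsto p hp').comp tendsto_natCast_atTop_atTop
    have h3 := (((h1.comp hpn).div h1 one_ne_zero).mul h2).const_mul ((p : ℝ) ^ β)
    rw [div_one, mul_one, mul_one] at h3
    refine h3.congr' ?_
    filter_upwards [eventually_gt_atTop 0, h1.eventually_ne one_ne_zero] with n hn hn1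
    have hn' : (0 : ℝ) < n := Nat.cast_pos.2 hn
    have e1 := (hl.pos n hn').ne'
    have e2 := (hl.pos (p * n) (by positivity)).ne'
    have e3 : (wanderingRate T μ Y n).toReal ≠ 0 := by
      intro h0
      simp [h0] at hn1
    simp only [Function.comp, Pi.div_apply]
    push_cast
    rw [Real.mul_rpow hp'.le hn'.le]
    have e4 : (p : ℝ) ^ β ≠ 0 := by positivity
    have e5 : (n : ℝ) ^ β ≠ 0 := by positivity
    field_simp

/-- A point of T^{-t}E is in `Y` at time t, so it has a unique first entrance time j ≤ t. The pieces
partition T^{-t}E, whose measure is μ(E) by invariance. -/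
lemma sum_firstEntrance (hT : MeasurePreserving T μ μ) (hY : MeasurableSet Y) {E : Set X}
    (hE : MeasurableSet E) (hEY : E ⊆ Y) (t : ℕ) :
    ∑ p ∈ Finset.HasAntidiagonal.antidiagonal t,
      μ (firstEntrance T Y p.1 ∩ T^[p.1] ⁻¹' (T^[p.2] ⁻¹' E)) = μ E := by
  have hpre : ∀ n, MeasurableSet (T^[n] ⁻¹' E) := fun n => (hT.iterate n).measurable hE
  have h1 : ∑ p ∈ Finset.HasAntidiagonal.antidiagonal t,
      μ (firstEntrance T Y p.1 ∩ T^[p.1] ⁻¹' (T^[p.2] ⁻¹' E)) =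
      ∑ j ∈ Finset.range (t + 1), μ (firstEntrance T Y j ∩ T^[t] ⁻¹' E) := by
    rw [Finset.Nat.sum_antidiagonal_eq_sum_range_succ_mk]
    refine Finset.sum_congr rfl fun j hj => ?_
    have hj : j ≤ t := Nat.lt_succ_iff.1 (Finset.mem_range.1 hj)
    rw [← Set.preimage_comp, ← Function.iterate_add, Nat.sub_add_cancel hj]
  rw [h1, ← measure_biUnion_finset]
  · rw [← (hT.iterate t).measure_preimage hE.nullMeasurableSet]
    congr 1
    ext x
    simp only [Set.mem_iUnion, Finset.mem_range, Set.mem_inter_iff, exists_prop]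
    constructor
    · rintro ⟨j, -, -, hx⟩
      exact hx
    · intro hx
      obtain ⟨j, hj, hxj⟩ := exists_mem_firstEntrance (T := T) (Y := Y) (hEY hx)
      exact ⟨j, by omega, hxj, hx⟩
  · exact fun i _ j _ hij => (disjoint_firstEntrance hij).mono Set.inter_subset_left
      Set.inter_subset_left
  · exact fun j _ => (measurableSet_firstEntrance hT hY j).inter (hpre t)

lemma measure_firstEntrance_inter_le (hT : MeasurePreserving T μ μ) (hY : MeasurableSet Y)
    {F : Set X} (hF : MeasurableSet F) (j : ℕ) :
    μ (firstEntrance T Y j ∩ T^[j] ⁻¹' F) ≤ μ (Y ∩ F) := by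
  rw [← (hT.iterate j).measure_preimage (hY.inter hF).nullMeasurableSet]
  exact measure_mono fun x hx => ⟨hx.1.1, hx.2⟩

lemma setLIntegral_entranceDensity [SigmaFinite μ] (hT : MeasurePreserving T μ μ)
    (hY : MeasurableSet Y) {F : Set X} (hF : MeasurableSet F) (n : ℕ) :
    ∫⁻ x in F, entranceDensity T μ Y n x ∂μ = (wanderingRate T μ Y n)⁻¹ *
      ∑ j ∈ Finset.range n, μ (firstEntrance T Y j ∩ T^[j] ⁻¹' F) := by
  have hm : ∀ j, Measurable ((firstEntrance T Y j).indicator (1 : X → ℝ≥0∞)) := fun j =>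
    measurable_one.indicator (measurableSet_firstEntrance hT hY j)
  have hmt := fun j => measurable_transfer_iterate (T := T) (μ := μ) (hm j) j
  unfold entranceDensity
  rw [lintegral_const_mul _ (Finset.measurable_fun_sum _ fun j _ => hmt j),
    lintegral_finsetSum _ fun j _ => hmt j]
  congr 1
  refine Finset.sum_congr rfl fun j _ => ?_
  rw [setLIntegral_transfer_iterate hT _ _ hF,
    lintegral_indicator_one (measurableSet_firstEntrance hT hY j),
    Measure.restrict_apply (measurableSet_firstEntrance hT hY j)]

lemma measurable_entranceDensity (hT : MeasurePreserving T μ μ) (hY : MeasurableSet Y) (n : ℕ) :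
    Measurable (entranceDensity T μ Y n) := by
  unfold entranceDensity
  refine Measurable.const_mul (Finset.measurable_fun_sum _ fun j _ => ?_) _
  exact measurable_transfer_iterate
    (measurable_one.indicator (measurableSet_firstEntrance hT hY j)) j

lemma entranceDensity_ae_lt_top [SigmaFinite μ] (hT : MeasurePreserving T μ μ)
    (hY : MeasurableSet Y) (hpos : 0 < μ Y) (hfin : μ Y < ∞) {n : ℕ} (hn : 0 < n) :
    ∀ᵐ x ∂μ, entranceDensity T μ Y n x < ∞ := by
  refine ae_lt_top (measurable_entranceDensity hT hY n) ?_
  rw [← setLIntegral_univ, setLIntegral_entranceDensity hT hY MeasurableSet.univ]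
  refine ENNReal.mul_ne_top (ENNReal.inv_ne_top.2 (wanderingRate_pos hpos hn).ne')
    (ENNReal.sum_ne_top.2 fun j _ => ?_)
  refine ((measure_firstEntrance_inter_le hT hY MeasurableSet.univ j).trans_lt ?_).ne
  simpa using hfin

/-- Each summand transports mass from Y_k by T^k into `Y`, so its integral over the complement of
`Y` vanishes. -/
lemma entranceDensity_ae_eq_zero [SigmaFinite μ] (hT : MeasurePreserving T μ μ)
    (hY : MeasurableSet Y) (n : ℕ) : ∀ᵐ x ∂μ, x ∉ Y → entranceDensity T μ Y n x = 0 := by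
  have h : ∫⁻ x in Yᶜ, entranceDensity T μ Y n x ∂μ = 0 := by
    rw [setLIntegral_entranceDensity hT hY hY.compl, Finset.sum_eq_zero, mul_zero]
    intro j _
    have := measure_firstEntrance_inter_le hT hY hY.compl j
    rw [Set.inter_compl_self, measure_empty] at this
    exact le_antisymm this zero_le
  rw [lintegral_eq_zero_iff (measurable_entranceDensity hT hY n)] at h
  exact (ae_restrict_iff' hY.compl).1 h

end InfiniteErgodic

/-! ### The limit density: domination, renewal error and sweeping -/

namespace InfiniteErgodic

variable {X : Type*} [MeasurableSpace X] {μ : Measure X} {T : X → X} {Y : Set X}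

lemma eventually_ae_abs_sub_le {H : X → ℝ} (hlim : Tendsto (fun n : ℕ =>
      eLpNorm (fun x => (entranceDensity T μ Y n x).toReal - H x) ∞ μ) atTop (𝓝 0))
    {ε : ℝ≥0} (hε : 0 < ε) :
    ∀ᶠ n in atTop, ∀ᵐ x ∂μ, |(entranceDensity T μ Y n x).toReal - H x| ≤ ε := by
  have hε' : (0 : ℝ≥0∞) < ε := ENNReal.coe_pos.2 hε
  filter_upwards [hlim.eventually (gt_mem_nhds hε')] with n hn
  rw [eLpNorm_exponent_top] at hn
  filter_upwards [ae_le_eLpNormEssSup (μ := μ)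
    (f := fun x => (entranceDensity T μ Y n x).toReal - H x)] with x hx
  have h1 := hx.trans hn.le
  rw [enorm_eq_nnnorm, ENNReal.coe_le_coe] at h1
  rw [← Real.norm_eq_abs, ← coe_nnnorm]
  exact_mod_cast h1

lemma limit_ae_eq_zero [SigmaFinite μ] (hT : MeasurePreserving T μ μ) (hY : MeasurableSet Y)
    {H : X → ℝ} (hlim : Tendsto (fun n : ℕ =>
      eLpNorm (fun x => (entranceDensity T μ Y n x).toReal - H x) ∞ μ) atTop (𝓝 0)) :
    ∀ᵐ x ∂μ, x ∉ Y → H x = 0 := by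
  have h1 : ∀ k : ℕ, ∀ᵐ x ∂μ, x ∉ Y → |H x| ≤ 1 / ((k : ℝ) + 1) := by
    intro k
    obtain ⟨n, hn⟩ := (eventually_ae_abs_sub_le hlim
      (ε := 1 / ((k : ℝ≥0) + 1)) (by positivity)).exists
    filter_upwards [hn, entranceDensity_ae_eq_zero hT hY n] with x hx hx0 hxY
    rw [hx0 hxY, ENNReal.toReal_zero, zero_sub, abs_neg] at hx
    simpa using hx
  filter_upwards [ae_all_iff.2 h1] with x hx hxY
  have h2 : |H x| ≤ 0 :=
    ge_of_tendsto' tendsto_one_div_add_atTop_nhds_zero_nat fun k => hx k hxY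
  exact abs_nonpos_iff.1 h2

/-- The measure with density `H`. -/
noncomputable def limitMeasure (μ : Measure X) (H : X → ℝ) : Measure X :=
  μ.withDensity fun x => ENNReal.ofReal (H x)

section Limit

variable [SigmaFinite μ] (hT : MeasurePreserving T μ μ) (hY : MeasurableSet Y)
  (hpos : 0 < μ Y) (hfin : μ Y < ∞) {H : X → ℝ} (hH : MemLp H ∞ μ)
  (hlim : Tendsto (fun n : ℕ =>
      eLpNorm (fun x => (entranceDensity T μ Y n x).toReal - H x) ∞ μ) atTop (𝓝 0))

include hT hY hH hlim in
lemma exists_limitMeasure_le :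
    ∃ M : ℝ≥0, ∀ F, MeasurableSet F → limitMeasure μ H F ≤ M * μ (Y ∩ F) := by
  refine ⟨(eLpNorm H ∞ μ).toNNReal, fun F hF => ?_⟩
  rw [limitMeasure, withDensity_apply _ hF, ENNReal.coe_toNNReal hH.2.ne]
  calc ∫⁻ x in F, ENNReal.ofReal (H x) ∂μ
      ≤ ∫⁻ x in F, eLpNorm H ∞ μ * Y.indicator 1 x ∂μ := by
        refine lintegral_mono_ae (ae_restrict_of_ae ?_)
        rw [eLpNorm_exponent_top]
        filter_upwards [limit_ae_eq_zero hT hY hlim, ae_le_eLpNormEssSup (μ := μ) (f := H)]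
          with x h0 h1
        by_cases hx : x ∈ Y
        · simp only [hx, Set.indicator_of_mem, Pi.one_apply, mul_one]
          exact Real.ofReal_le_enorm _ |>.trans h1
        · simp [h0 hx]
    _ = eLpNorm H ∞ μ * μ (Y ∩ F) := by
        rw [lintegral_const_mul _ (measurable_one.indicator hY), lintegral_indicator_one hY,
          Measure.restrict_apply hY]

include hT hY hpos hfin hlim in
-- Both densities vanish almost everywhere off `Y`, so closeness within ε in `L^∞` improves to
-- ε·1_Y. The error is then proportional to μ(Y ∩ F), which sweeping can absorb.
lemma eventually_setLIntegral_le {ε : ℝ≥0} (hε : 0 < ε) :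
    ∀ᶠ n in atTop, ∀ F, MeasurableSet F →
      ∫⁻ x in F, entranceDensity T μ Y n x ∂μ ≤ limitMeasure μ H F + ε * μ (Y ∩ F) ∧
      limitMeasure μ H F ≤ ∫⁻ x in F, entranceDensity T μ Y n x ∂μ + ε * μ (Y ∩ F) := by
  have hind : ∀ F, ε * μ (Y ∩ F) = ∫⁻ x in F, ε * Y.indicator 1 x ∂μ := fun F => by
    rw [lintegral_const_mul _ (measurable_one.indicator hY), lintegral_indicator_one hY,
      Measure.restrict_apply hY]
  have hindm : Measurable fun x => (ε : ℝ≥0∞) * Y.indicator 1 x :=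
    (measurable_one.indicator hY).const_mul _
  filter_upwards [eventually_ae_abs_sub_le hlim hε, eventually_gt_atTop 0] with n hn hn0 F hF
  have hae : ∀ᵐ x ∂μ, entranceDensity T μ Y n x ≤
      ENNReal.ofReal (H x) + ε * Y.indicator 1 x ∧
      ENNReal.ofReal (H x) ≤ entranceDensity T μ Y n x + ε * Y.indicator 1 x := by
    filter_upwards [hn, limit_ae_eq_zero hT hY hlim, entranceDensity_ae_eq_zero hT hY n,
      entranceDensity_ae_lt_top hT hY hpos hfin hn0] with x h1 h2 h3 h4
    by_cases hx : x ∈ Y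
    · simp only [hx, Set.indicator_of_mem, Pi.one_apply, mul_one]
      rw [abs_le] at h1
      have e : (ε : ℝ≥0∞) = ENNReal.ofReal ε := by simp
      constructor
      · rw [← ENNReal.ofReal_toReal h4.ne, e]
        exact (ENNReal.ofReal_le_ofReal (by linarith)).trans ENNReal.ofReal_add_le
      · rw [e]
        rw [← ENNReal.ofReal_toReal h4.ne]
        rw [← ENNReal.ofReal_add ENNReal.toReal_nonneg ε.coe_nonneg]
        exact ENNReal.ofReal_le_ofReal (by linarith)
    · simp [hx, h2 hx, h3 hx]
  rw [limitMeasure, withDensity_apply _ hF, hind, ← lintegral_add_right _ hindm,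
    ← lintegral_add_right _ hindm]
  exact ⟨lintegral_mono_ae (ae_restrict_of_ae (hae.mono fun x hx => hx.1)),
    lintegral_mono_ae (ae_restrict_of_ae (hae.mono fun x hx => hx.2))⟩

include hT hY hpos hfin hH hlim in
lemma exists_renewal_error {ε : ℝ≥0} (hε : 0 < ε) :
    ∃ D : ℝ≥0, ∀ N F, MeasurableSet F →
      (∑ j ∈ Finset.range (N + 1), μ (firstEntrance T Y j ∩ T^[j] ⁻¹' F) ≤
        wanderingRate T μ Y (N + 1) * limitMeasure μ H F +
          (ε * wanderingRate T μ Y (N + 1) + D) * μ (Y ∩ F)) ∧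
      (wanderingRate T μ Y (N + 1) * limitMeasure μ H F ≤
        ∑ j ∈ Finset.range (N + 1), μ (firstEntrance T Y j ∩ T^[j] ⁻¹' F) +
          (ε * wanderingRate T μ Y (N + 1) + D) * μ (Y ∩ F)) := by
  obtain ⟨N₀, hN₀⟩ := eventually_atTop.1 (eventually_setLIntegral_le hT hY hpos hfin hlim hε)
  obtain ⟨M, hM⟩ := exists_limitMeasure_le hT hY hH hlim
  -- D covers the finitely many N with N + 1 < N₀: the sum has at most N₀ terms, each at most μ(Y ∩
  -- F), and the main term is at most w(N₀) M μ(Y ∩ F).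
  refine ⟨N₀ + (wanderingRate T μ Y N₀).toNNReal * M, fun N F hF => ?_⟩
  have hwT := wanderingRate_ne_top hT hY hfin
  rcases le_or_gt N₀ (N + 1) with hN | hN
  · obtain ⟨h1, h2⟩ := hN₀ (N + 1) hN F hF
    rw [setLIntegral_entranceDensity hT hY hF] at h1 h2
    have hw0 := (wanderingRate_pos (T := T) hpos N.succ_pos).ne'
    have hwt := hwT (N + 1)
    set W := wanderingRate T μ Y (N + 1)
    set S := ∑ j ∈ Finset.range (N + 1), μ (firstEntrance T Y j ∩ T^[j] ⁻¹' F)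
    have h1 := mul_le_mul_right h1 W
    have h2 := mul_le_mul_right h2 W
    rw [← mul_assoc, ENNReal.mul_inv_cancel hw0 hwt, one_mul, mul_add] at h1
    rw [mul_add, ← mul_assoc, ENNReal.mul_inv_cancel hw0 hwt, one_mul] at h2
    have h3 : W * (ε * μ (Y ∩ F)) ≤
        (ε * W + (N₀ + (wanderingRate T μ Y N₀).toNNReal * M : ℝ≥0)) * μ (Y ∩ F) := by
      rw [← mul_assoc, mul_comm W]
      gcongr
      exact le_self_add
    exact ⟨h1.trans (by gcongr), h2.trans (by gcongr)⟩
  · have hco : (((N₀ : ℝ≥0) + (wanderingRate T μ Y N₀).toNNReal * M : ℝ≥0) : ℝ≥0∞) =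
        N₀ + wanderingRate T μ Y N₀ * M := by
      push_cast
      rw [ENNReal.coe_toNNReal (hwT N₀)]
    rw [hco]
    constructor
    · calc ∑ j ∈ Finset.range (N + 1), μ (firstEntrance T Y j ∩ T^[j] ⁻¹' F)
          ≤ (N + 1 : ℕ) * μ (Y ∩ F) := by
            refine (Finset.sum_le_card_nsmul _ _ _ fun j _ =>
              measure_firstEntrance_inter_le hT hY hF j).trans ?_
            simp
        _ ≤ N₀ * μ (Y ∩ F) := by gcongr
        _ ≤ (ε * wanderingRate T μ Y (N + 1) + (N₀ + wanderingRate T μ Y N₀ * M)) * μ (Y ∩ F) := by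
            gcongr
            exact le_add_left le_self_add
        _ ≤ _ := le_add_self
    · calc wanderingRate T μ Y (N + 1) * limitMeasure μ H F
          ≤ wanderingRate T μ Y N₀ * (M * μ (Y ∩ F)) := by
            gcongr
            · exact wanderingRate_mono hN.le
            · exact hM F hF
        _ = (wanderingRate T μ Y N₀ * M) * μ (Y ∩ F) := by rw [mul_assoc]
        _ ≤ (ε * wanderingRate T μ Y (N + 1) + (N₀ + wanderingRate T μ Y N₀ * M)) * μ (Y ∩ F) := by
            gcongr
            exact le_add_left le_add_self
        _ ≤ _ := le_add_self

include hT hY hpos hfin hlim in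
lemma exists_limitMeasure_sweeping (hsweep : ∃ N : ℕ, 1 ≤ N ∧ UniformlySweeping T μ
      {u | ∃ n, N ≤ n ∧ u = entranceDensity T μ Y n} (Y.indicator 1)) :
    ∃ (C : ℝ≥0) (K : ℕ), ∀ F, MeasurableSet F →
      μ (Y ∩ F) ≤ C * ∑ r ∈ Finset.range (K + 1), limitMeasure μ H (T^[r] ⁻¹' F) := by
  obtain ⟨N, -, C, -, K, hCK⟩ := hsweep
  refine ⟨C, K, fun F hF => ENNReal.le_of_forall_pos_le_add fun δ hδ _ => ?_⟩
  -- Sweeping passes from the approximants to the limit. Replacing the approximant on each of the K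
  -- + 1 preimages costs at most ε μ(Y), hence c ε in all, and ε = δ/(c + 1) keeps this below δ.
  set c : ℝ≥0 := C * ((K + 1) * (μ Y).toNNReal) with hc
  have hε : 0 < δ / (c + 1) := by positivity
  obtain ⟨n, hn, hnN⟩ := ((eventually_setLIntegral_le hT hY hpos hfin hlim hε).and
    (eventually_ge_atTop N)).exists
  have hsw := hCK _ ⟨n, hnN, rfl⟩
  have hpre : ∀ r, MeasurableSet (T^[r] ⁻¹' F) := fun r => (hT.iterate r).measurable hF
  calc μ (Y ∩ F) = ∫⁻ x in F, Y.indicator 1 x ∂μ := by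
        rw [lintegral_indicator_one hY, Measure.restrict_apply hY]
    _ ≤ ∫⁻ x in F, C * ∑ r ∈ Finset.range (K + 1),
          (transfer T μ)^[r] (entranceDensity T μ Y n) x ∂μ :=
        lintegral_mono_ae (ae_restrict_of_ae hsw)
    _ = C * ∑ r ∈ Finset.range (K + 1), ∫⁻ x in T^[r] ⁻¹' F, entranceDensity T μ Y n x ∂μ := by
        have hm := fun r => measurable_transfer_iterate (T := T) (μ := μ)
          (measurable_entranceDensity hT hY n) r
        rw [lintegral_const_mul _ (Finset.measurable_fun_sum _ fun r _ => hm r),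
          lintegral_finsetSum _ fun r _ => hm r]
        simp_rw [setLIntegral_transfer_iterate hT _ _ hF]
    _ ≤ C * ∑ r ∈ Finset.range (K + 1),
          (limitMeasure μ H (T^[r] ⁻¹' F) + (δ / (c + 1) : ℝ≥0) * μ Y) := by
        gcongr with r
        refine (hn _ (hpre r)).1.trans ?_
        gcongr
        exact Set.inter_subset_left
    _ = C * ∑ r ∈ Finset.range (K + 1), limitMeasure μ H (T^[r] ⁻¹' F) +
          (c * (δ / (c + 1)) : ℝ≥0) := by
        rw [Finset.sum_add_distrib, mul_add, Finset.sum_const, Finset.card_range, nsmul_eq_mul, hc]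
        congr 1
        rw [ENNReal.coe_mul, ENNReal.coe_mul, ENNReal.coe_mul, ENNReal.coe_toNNReal hfin.ne]
        push_cast
        ring
    _ ≤ _ := by
        gcongr
        rw [← mul_div_assoc, div_le_iff₀ (by positivity), mul_comm]
        gcongr
        exact le_self_add

include hT hY hpos hfin hH hlim in
/-- Uniform asymptotics of the truncated Green measures of the limit density. -/
theorem tendsto_sum_limitMeasure (hsweep : ∃ N : ℕ, 1 ≤ N ∧ UniformlySweeping T μ
      {u | ∃ n, N ≤ n ∧ u = entranceDensity T μ Y n} (Y.indicator 1)) {β : ℝ} (hβ1 : β < 1)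
    (hw : ConcaveRegVar (fun n => (wanderingRate T μ Y n).toReal) β)
    {E : ℕ → Set X} (hE : ∀ n, MeasurableSet (E n)) (hEY : ∀ n, E n ⊆ Y)
    (hE0 : ∀ᶠ n in atTop, μ (E n) ≠ 0) {m : ℕ → ℕ} (hm : Tendsto m atTop atTop) :
    Tendsto (fun n => (wanderingRate T μ Y (m n)).toReal / (m n * (μ (E n)).toReal) *
      ∑ i ∈ Finset.range (m n + 1), (limitMeasure μ H (T^[i] ⁻¹' E n)).toReal) atTop
      (𝓝 (1 / (Real.Gamma (β + 1) * Real.Gamma (1 - β + 1)))) := by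
  classical
  obtain ⟨M, hM⟩ := exists_limitMeasure_le hT hY hH hlim
  obtain ⟨C, K, hCK⟩ := exists_limitMeasure_sweeping hT hY hpos hfin hlim hsweep
  -- The renewal theorem wants positivity for every n, so null sets are replaced by `Y` and m by max
  -- m 1; neither replacement matters eventually.
  set E' : ℕ → Set X := fun n => if μ (E n) = 0 then Y else E n with hE'
  set m' : ℕ → ℕ := fun n => max (m n) 1 with hm'
  have hE'm : ∀ n, MeasurableSet (E' n) := fun n => by
    simp only [hE']
    split_ifs
    exacts [hY, hE n]
  have hE'Y : ∀ n, E' n ⊆ Y := fun n => by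
    simp only [hE']
    split_ifs
    exacts [subset_rfl, hEY n]
  have hE'0 : ∀ n, μ (E' n) ≠ 0 := fun n => by
    simp only [hE']
    split_ifs with h
    exacts [hpos.ne', h]
  have hpre : ∀ n i, MeasurableSet (T^[i] ⁻¹' E' n) := fun n i =>
    (hT.iterate i).measurable (hE'm n)
  have hofR : ∀ n, ENNReal.ofReal (wanderingRate T μ Y n).toReal = wanderingRate T μ Y n :=
    fun n => ENNReal.ofReal_toReal (wanderingRate_ne_top hT hY hfin n)
  have key := tendsto_sum_of_renewal hw hβ1 (m := m') (e := fun n => μ (E' n))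
    (a := fun n i => limitMeasure μ H (T^[i] ⁻¹' E' n))
    (y := fun n i => μ (Y ∩ T^[i] ⁻¹' E' n))
    (b := fun n j i => μ (firstEntrance T Y j ∩ T^[j] ⁻¹' (T^[i] ⁻¹' E' n)))
    (C := C) (M := M * (μ Y).toNNReal) (K := K) hE'0
    (fun n => ((measure_mono (hE'Y n)).trans_lt hfin).ne)
    (tendsto_atTop_mono (fun n => le_max_left _ _) hm) (fun n => by simp [hm'])
    (fun n i => by
      refine (hM _ (hpre n i)).trans ?_
      rw [ENNReal.coe_mul, ENNReal.coe_toNNReal hfin.ne]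
      gcongr
      exact Set.inter_subset_left)
    (fun n t => sum_firstEntrance hT hY (hE'm n) (hE'Y n) t)
    (fun ε hε => by
      obtain ⟨D, hD⟩ := exists_renewal_error hT hY hpos hfin hH hlim hε
      refine ⟨D, fun n N i => ?_⟩
      rw [hofR]
      exact hD N _ (hpre n i))
    (fun n i => by
      refine (hCK _ (hpre n i)).trans (le_of_eq ?_)
      simp only [← Set.preimage_comp, ← Function.iterate_add])
  refine key.congr' ?_
  filter_upwards [hE0, hm.eventually_ge_atTop 1] with n h1 h2
  have e1 : E' n = E n := if_neg h1
  have e2 : m' n = m n := max_eq_left h2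
  simp only [e1, e2]

end Limit
end InfiniteErgodic

/-! ### Last-visit decomposition and normalisation -/

namespace InfiniteErgodic

section Visits

variable {X : Type*} {T : X → X} {Y : Set X}

/-- The points whose orbit avoids `Y` at all times in `(m, n]`. -/
def avoids (T : X → X) (Y : Set X) (m n : ℕ) : Set X :=
  {x | ∀ j, m < j → j ≤ n → T^[j] x ∉ Y}

lemma lastVisit_le_iff {m n : ℕ} {x : X} : lastVisit T Y n x ≤ m ↔ x ∈ avoids T Y m n := by
  classical
  unfold lastVisit
  constructor
  · intro h j hmj hjn hj
    have := Nat.le_findGreatest (P := fun k => T^[k] x ∈ Y) hjn hj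
    omega
  · intro h
    by_contra! hc
    exact h _ hc (Nat.findGreatest_le n)
      (Nat.findGreatest_of_ne_zero (P := fun k => T^[k] x ∈ Y) rfl (by omega))

lemma lastVisit_div_le_iff {n : ℕ} (hn : 0 < n) {c : ℝ} (hc : 0 < c) {x : X} :
    (lastVisit T Y n x : ℝ) / n ≤ c ↔ x ∈ avoids T Y ⌊c * n⌋₊ n := by
  have hn' : (0 : ℝ) < n := Nat.cast_pos.2 hn
  rw [div_le_iff₀ hn', ← lastVisit_le_iff, Nat.le_floor_iff (by positivity)]

lemma disjoint_preimage_noReturn {i j n : ℕ} (hij : i ≠ j) (hi : i ≤ n) (hj : j ≤ n) :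
    Disjoint (T^[i] ⁻¹' noReturn T Y n) (T^[j] ⁻¹' noReturn T Y n) := by
  wlog h : i < j generalizing i j
  · exact (this hij.symm hj hi (by omega)).symm
  refine Set.disjoint_left.2 fun x hx hx' => ?_
  refine (mem_noReturn.1 hx).2 (j - i - 1) (by omega) ?_
  have e : j - i - 1 + 1 + i = j := by omega
  rw [← Function.iterate_add_apply, e]
  exact (mem_noReturn.1 hx').1

/-- After a visit at time i ≤ m the orbit avoids `Y` throughout (i, i + n + k], which contains (m +
k, n + k]. -/
lemma preimage_noReturn_subset {i m n k : ℕ} (hi : i ≤ m) :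
    T^[i] ⁻¹' noReturn T Y (n + k) ⊆ T^[k] ⁻¹' avoids T Y m n := by
  intro x hx j hmj hjn hj
  refine (mem_noReturn.1 hx).2 (j + k - i - 1) (by omega) ?_
  have e : j + k - i - 1 + 1 + i = j + k := by omega
  rw [← Function.iterate_add_apply] at hj ⊢
  rwa [e]

/-- Starting in `Y` guarantees a last visit in [0, n + k]. It occurs at some i ≤ m + k, and the
remaining n + k - i ≥ n - m steps contain no return. -/
lemma inter_preimage_avoids_subset {m n k : ℕ} (hmn : m ≤ n) :
    Y ∩ T^[k] ⁻¹' avoids T Y m n ⊆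
      ⋃ i ∈ Finset.range (m + k + 1), T^[i] ⁻¹' noReturn T Y (n - m) := by
  classical
  rintro x ⟨hxY, hx⟩
  set i := Nat.findGreatest (fun i => T^[i] x ∈ Y) (n + k) with hi
  have hiY : T^[i] x ∈ Y :=
    Nat.findGreatest_spec (P := fun i => T^[i] x ∈ Y) (Nat.zero_le (n + k)) hxY
  have hin : i ≤ n + k := Nat.findGreatest_le _
  have him : i ≤ m + k := by
    by_contra! hc
    refine hx (i - k) (by omega) (by omega) ?_
    rw [← Function.iterate_add_apply, Nat.sub_add_cancel (by omega)]
    exact hiY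
  refine Set.mem_biUnion (Finset.mem_coe.2 (Finset.mem_range.2 (Nat.lt_succ_of_le him))) ?_
  refine mem_noReturn.2 ⟨hiY, fun l hl hlY => ?_⟩
  rw [← Function.iterate_add_apply] at hlY
  have := Nat.le_findGreatest (P := fun i => T^[i] x ∈ Y) (n := n + k) (by omega) hlY
  omega

end Visits

variable {X : Type*} [MeasurableSpace X] {μ : Measure X} {T : X → X} {Y : Set X}

lemma measurableSet_avoids (hT : MeasurePreserving T μ μ) (hY : MeasurableSet Y) (m n : ℕ) :
    MeasurableSet (avoids T Y m n) := by
  simp only [avoids, Set.ofPred_forall]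
  exact MeasurableSet.iInter fun j => MeasurableSet.iInter fun _ => MeasurableSet.iInter fun _ =>
    (hT.iterate j).measurable hY.compl

lemma sum_noReturn_le {ν : Measure X} (hT : MeasurePreserving T μ μ) (hY : MeasurableSet Y)
    {m n : ℕ} (k : ℕ) (hmn : m ≤ n) :
    ∑ i ∈ Finset.range (m + 1), ν (T^[i] ⁻¹' noReturn T Y (n + k)) ≤
      ν (T^[k] ⁻¹' avoids T Y m n) := by
  have hle : ∀ i ∈ Finset.range (m + 1), i ≤ m := fun i hi =>
    Nat.lt_succ_iff.1 (Finset.mem_range.1 hi)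
  rw [← measure_biUnion_finset]
  · exact measure_mono (Set.iUnion₂_subset fun i hi => preimage_noReturn_subset (hle i hi))
  · intro i hi j hj hij
    have h1 := hle i hi
    have h2 := hle j hj
    exact disjoint_preimage_noReturn hij (by omega) (by omega)
  · exact fun i _ => (hT.iterate i).measurable (measurableSet_noReturn hT hY _)

lemma le_sum_noReturn {ν : Measure X} (hν : ν Yᶜ = 0) {m n : ℕ} (k : ℕ) (hmn : m ≤ n) :
    ν (T^[k] ⁻¹' avoids T Y m n) ≤
      ∑ i ∈ Finset.range (m + k + 1), ν (T^[i] ⁻¹' noReturn T Y (n - m)) := by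
  calc ν (T^[k] ⁻¹' avoids T Y m n)
      ≤ ν (Y ∩ T^[k] ⁻¹' avoids T Y m n) + ν Yᶜ := by
        refine (measure_mono fun x hx => ?_).trans (measure_union_le _ _)
        by_cases h : x ∈ Y
        exacts [Or.inl ⟨h, hx⟩, Or.inr h]
    _ ≤ _ := by
        rw [hν, add_zero]
        exact (measure_mono (inter_preimage_avoids_subset hmn)).trans
          (measure_biUnion_finset_le _ _)

lemma tendsto_floor_mul_self_div {c : ℕ → ℝ} (hc_top : Tendsto (fun n : ℕ => c n * n) atTop atTop) :
    Tendsto (fun n : ℕ => (⌊c n * n⌋₊ : ℝ) / (c n * n)) atTop (𝓝 1) :=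
  (tendsto_nat_floor_div_atTop (R := ℝ)).comp hc_top

lemma tendsto_floor_mul_self_div_self {c : ℕ → ℝ} (hc_zero : Tendsto c atTop (𝓝 0))
    (hc_top : Tendsto (fun n : ℕ => c n * n) atTop atTop) :
    Tendsto (fun n : ℕ => (⌊c n * n⌋₊ : ℝ) / n) atTop (𝓝 0) := by
  have h := (tendsto_floor_mul_self_div hc_top).mul hc_zero
  rw [one_mul] at h
  refine h.congr' ?_
  filter_upwards [eventually_gt_atTop 0, hc_top.eventually_gt_atTop 0] with n hn hcn
  have hn' : (n : ℝ) ≠ 0 := (Nat.cast_pos.2 hn).ne'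
  have hcn' : c n ≠ 0 := left_ne_zero_of_mul hcn.ne'
  field_simp

/-- Comparison of the slowly varying normalisation with the wandering rate. -/
lemma tendsto_slowlyVarying_mul {w : ℕ → ℝ} {α : ℝ} {l : ℝ → ℝ} (hl : IsSlowlyVarying l)
    (hw : w ~[atTop] fun n : ℕ => (n : ℝ) ^ (1 - α) * l n)
    {c : ℕ → ℝ} (hc_pos : ∀ n, 0 < c n)
    (hc_top : Tendsto (fun n : ℕ => c n * n) atTop atTop) :
    Tendsto (fun n : ℕ => c n ^ α * l n / l (c n * n) *
      (w ⌊c n * n⌋₊ / ⌊c n * n⌋₊ * (n / w n))) atTop (𝓝 1) := by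
  have hm : Tendsto (fun n : ℕ => ⌊c n * n⌋₊) atTop atTop := tendsto_nat_floor_atTop.comp hc_top
  have h1 := tendsto_div_of_isEquivalent hl hw
  have hfl := tendsto_floor_mul_self_div hc_top
  have hm0 : ∀ᶠ n : ℕ in atTop, (0 : ℝ) < ⌊c n * n⌋₊ := by
    filter_upwards [hm.eventually_gt_atTop 0] with n hn using Nat.cast_pos.2 hn
  have h2 := hl.tendsto_div hc_top hm0 hfl
  have h3 := hfl.rpow_const (p := -α) (Or.inl one_ne_zero)
  have h4 := (h3.mul h2).mul ((h1.comp hm).div h1 one_ne_zero)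
  rw [Real.one_rpow, mul_one, div_one, mul_one] at h4
  refine h4.congr' ?_
  filter_upwards [eventually_gt_atTop 0, hm0, h1.eventually_ne one_ne_zero] with n hn hmn hwn
  have hn' : (0 : ℝ) < n := Nat.cast_pos.2 hn
  have hcn := hc_pos n
  have e1 := (hl.pos n hn').ne'
  have e2 := (hl.pos _ hmn).ne'
  have e3 := (hl.pos (c n * n) (by positivity)).ne'
  have e4 : w n ≠ 0 := fun h0 => by simp [h0] at hwn
  simp only [Function.comp, Pi.div_apply]
  rw [Real.div_rpow hmn.le (by positivity), Real.rpow_neg hmn.le, Real.rpow_neg (by positivity),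
    Real.mul_rpow hcn.le hn'.le, Real.rpow_sub hn', Real.rpow_sub hmn, Real.rpow_one,
    Real.rpow_one]
  have e5 : c n ^ α ≠ 0 := by positivity
  have e6 : (n : ℝ) ^ α ≠ 0 := by positivity
  have e7 : ((⌊c n * n⌋₊ : ℕ) : ℝ) ^ α ≠ 0 := by positivity
  field_simp

/-- `n' q(n') / w(n')` transferred to the normalisation at `n`. -/
lemma ConcaveRegVar.tendsto_mul_diff_comp {w : ℕ → ℝ} {β : ℝ} (h : ConcaveRegVar w β)
    {p : ℕ → ℕ} (hp : Tendsto p atTop atTop)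
    (hpn : Tendsto (fun n : ℕ => (p n : ℝ) / n) atTop (𝓝 1)) :
    Tendsto (fun n : ℕ => n / w n * (w (p n + 1) - w (p n))) atTop (𝓝 β) := by
  have h1 := (h.tendsto_mul_diff.comp hp).mul
    ((h.tendsto_div_of_tendsto_one (eventually_gt_atTop 0) hpn).div hpn one_ne_zero)
  rw [div_one, mul_one] at h1
  refine h1.congr' ?_
  filter_upwards [eventually_gt_atTop 0, hp.eventually_gt_atTop 0] with n hn hpn
  have a1 := (h.pos n hn).ne'
  have a2 := (h.pos _ hpn).ne'
  have a3 : (n : ℝ) ≠ 0 := (Nat.cast_pos.2 hn).ne'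
  have a4 : (p n : ℝ) ≠ 0 := (Nat.cast_pos.2 hpn).ne'
  simp only [Function.comp, Pi.div_apply]
  field_simp

/-- The product of Gamma values is α(1-α)Γ(α)Γ(1-α); Euler's reflection formula applies and the
factor 1 - α cancels. -/
lemma gamma_reflection {α : ℝ} (hα : α ∈ Set.Ioo (0 : ℝ) 1) :
    1 / (Real.Gamma (1 - α + 1) * Real.Gamma (1 - (1 - α) + 1)) * (1 - α) =
      Real.sin (Real.pi * α) / (Real.pi * α) := by
  have h0 := hα.1
  have h1 : 0 < 1 - α := by linarith [hα.2]
  have hs : 0 < Real.sin (Real.pi * α) :=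
    Real.sin_pos_of_pos_of_lt_pi (by positivity) (by nlinarith [Real.pi_pos, hα.2])
  have hrefl := Real.Gamma_mul_Gamma_one_sub α
  have g1 := Real.Gamma_pos_of_pos h0
  have g2 := Real.Gamma_pos_of_pos h1
  rw [sub_sub_cancel, Real.Gamma_add_one h0.ne', Real.Gamma_add_one h1.ne']
  rw [eq_div_iff hs.ne'] at hrefl
  have := Real.pi_pos
  field_simp
  rw [mul_comm Real.pi α] at hrefl
  linarith

/-- The event is squeezed between last-visit sums built from no-return sets of lengths n + k and n -
m. Since m = o(n) and k is fixed, both have the same asymptotics. -/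
theorem tendsto_limitMeasure_avoids [SigmaFinite μ] (hT : MeasurePreserving T μ μ)
    (hY : MeasurableSet Y) (hpos : 0 < μ Y) (hfin : μ Y < ∞) {H : X → ℝ} (hH : MemLp H ∞ μ)
    (hlim : Tendsto (fun n : ℕ =>
      eLpNorm (fun x => (entranceDensity T μ Y n x).toReal - H x) ∞ μ) atTop (𝓝 0))
    (hsweep : ∃ N : ℕ, 1 ≤ N ∧ UniformlySweeping T μ
      {u | ∃ n, N ≤ n ∧ u = entranceDensity T μ Y n} (Y.indicator 1)) {β : ℝ} (hβ1 : β < 1)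
    (hw : ConcaveRegVar (fun n => (wanderingRate T μ Y n).toReal) β)
    {m : ℕ → ℕ} (hm : Tendsto m atTop atTop)
    (hmn : Tendsto (fun n : ℕ => (m n : ℝ) / n) atTop (𝓝 0)) (k : ℕ) :
    Tendsto (fun n : ℕ => (limitMeasure μ H (T^[k] ⁻¹' avoids T Y (m n) n)).toReal *
      ((wanderingRate T μ Y (m n)).toReal / m n * (n / (wanderingRate T μ Y n).toReal))) atTop
      (𝓝 (1 / (Real.Gamma (β + 1) * Real.Gamma (1 - β + 1)) * β)) := by
  set w : ℕ → ℝ := fun n => (wanderingRate T μ Y n).toReal with hwdef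
  set ν := limitMeasure μ H with hν
  obtain ⟨M, hM⟩ := exists_limitMeasure_le hT hY hH hlim
  have hνY : ν Yᶜ = 0 := by
    have := hM _ hY.compl
    rwa [Set.inter_compl_self, measure_empty, mul_zero, nonpos_iff_eq_zero] at this
  have hνfin : ∀ F, ν F ≠ ∞ := fun F => by
    refine ne_top_of_le_ne_top ?_ (measure_mono (Set.subset_univ F))
    refine ne_top_of_le_ne_top ?_ (hM _ MeasurableSet.univ)
    rw [Set.inter_univ]
    exact ENNReal.mul_ne_top ENNReal.coe_ne_top hfin.ne
  have hq : ∀ n, w (n + 1) - w n = (μ (noReturn T Y n)).toReal :=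
    toReal_wanderingRate_succ hT hY hfin
  have hne : ∀ᶠ n in atTop, μ (noReturn T Y n) ≠ 0 := by
    filter_upwards [hw.eventually_diff_pos] with n hn h0
    have := hq n
    simp only [hwdef] at this
    rw [this, h0] at hn
    simp at hn
  have hle : ∀ᶠ n in atTop, m n ≤ n := by
    filter_upwards [hmn.eventually (gt_mem_nhds one_pos), eventually_gt_atTop 0] with n h1 h2
    rw [div_lt_one (Nat.cast_pos.2 h2), Nat.cast_lt] at h1
    exact h1.le
  have hp1 : Tendsto (fun n => n + k) atTop atTop := tendsto_add_atTop_nat k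
  have hp1n : Tendsto (fun n : ℕ => ((n + k : ℕ) : ℝ) / n) atTop (𝓝 1) := by
    have := (tendsto_const_div_atTop_nhds_zero_nat (k : ℝ)).const_add 1
    rw [add_zero] at this
    refine this.congr' ?_
    filter_upwards [eventually_gt_atTop 0] with n hn
    have : (n : ℝ) ≠ 0 := (Nat.cast_pos.2 hn).ne'
    push_cast
    field_simp
  have hp2n : Tendsto (fun n : ℕ => ((n - m n : ℕ) : ℝ) / n) atTop (𝓝 1) := by
    have := hmn.const_sub 1
    rw [sub_zero] at this
    refine this.congr' ?_
    filter_upwards [eventually_gt_atTop 0, hle] with n hn hl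
    have : (n : ℝ) ≠ 0 := (Nat.cast_pos.2 hn).ne'
    rw [Nat.cast_sub hl]
    field_simp
  have hp2 : Tendsto (fun n => n - m n) atTop atTop := by
    refine tendsto_natCast_atTop_iff.1 ((tendsto_natCast_atTop_atTop (R := ℝ)).atTop_mul_pos
      one_pos hp2n |>.congr' ?_)
    filter_upwards [eventually_gt_atTop 0] with n hn
    have : (n : ℝ) ≠ 0 := (Nat.cast_pos.2 hn).ne'
    field_simp
  have hmk : Tendsto (fun n => m n + k) atTop atTop := (tendsto_add_atTop_nat k).comp hm
  have hm0 : ∀ᶠ n in atTop, 0 < m n := hm.eventually_gt_atTop 0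
  have hmkm : Tendsto (fun n : ℕ => ((m n : ℕ) : ℝ) / ((m n + k : ℕ) : ℝ)) atTop (𝓝 1) := by
    have h1 : Tendsto (fun j : ℕ => ((j + k : ℕ) : ℝ) / j) atTop (𝓝 1) := hp1n
    have h2 := (h1.comp hm).inv₀ one_ne_zero
    rw [inv_one] at h2
    refine h2.congr fun n => ?_
    simp
  have hlow := (tendsto_sum_limitMeasure hT hY hpos hfin hH hlim hsweep hβ1 hw
    (E := fun n => noReturn T Y (n + k)) (fun n => measurableSet_noReturn hT hY _)
    (fun n => noReturn_subset) (hp1.eventually hne) hm).mul (hw.tendsto_mul_diff_comp hp1 hp1n)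
  -- The upper sum runs up to m + k, so its natural normalisation is at m + k; the last factor,
  -- tending to 1, moves it back to m.
  have hupp := ((tendsto_sum_limitMeasure hT hY hpos hfin hH hlim hsweep hβ1 hw
    (E := fun n => noReturn T Y (n - m n)) (fun n => measurableSet_noReturn hT hY _)
    (fun n => noReturn_subset) (hp2.eventually hne) hmk).mul
      (hw.tendsto_mul_diff_comp hp2 hp2n)).mul
    ((hw.tendsto_div_of_tendsto_one (hmk.eventually_gt_atTop 0) hmkm).div hmkm one_ne_zero)
  rw [div_one, mul_one] at hupp
  refine tendsto_of_tendsto_of_tendsto_of_le_of_le' hlow hupp ?_ ?_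
  · filter_upwards [hle, hm0, eventually_gt_atTop 0, hp1.eventually hne] with n h1 h2 h3 h4
    have s1 := ENNReal.toReal_mono (hνfin _) (sum_noReturn_le (ν := ν) hT hY k h1)
    rw [ENNReal.toReal_sum fun i _ => hνfin _] at s1
    have e4 : (μ (noReturn T Y (n + k))).toReal ≠ 0 := (ENNReal.toReal_pos h4
      ((measure_mono noReturn_subset).trans_lt hfin).ne).ne'
    have a1 : 0 ≤ w (m n) / m n * (n / w n) :=
      mul_nonneg (div_nonneg (hw.nonneg _) (Nat.cast_nonneg _))
        (div_nonneg (Nat.cast_nonneg _) (hw.nonneg _))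
    refine le_trans (le_of_eq ?_) (mul_le_mul_of_nonneg_right s1 a1)
    rw [hq]
    have a2 : (m n : ℝ) ≠ 0 := (Nat.cast_pos.2 h2).ne'
    have a3 : w n ≠ 0 := (hw.pos n h3).ne'
    simp only [hwdef, hν] at a3 ⊢
    field_simp
  · filter_upwards [hle, hm0, eventually_gt_atTop 0, hp2.eventually hne] with n h1 h2 h3 h4
    have s1 := ENNReal.toReal_mono (ENNReal.sum_ne_top.2 fun i _ => hνfin _)
      (le_sum_noReturn (T := T) hνY k h1)
    rw [ENNReal.toReal_sum fun i _ => hνfin _] at s1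
    have e4 : (μ (noReturn T Y (n - m n))).toReal ≠ 0 := (ENNReal.toReal_pos h4
      ((measure_mono noReturn_subset).trans_lt hfin).ne).ne'
    have a1 : 0 ≤ w (m n) / m n * (n / w n) :=
      mul_nonneg (div_nonneg (hw.nonneg _) (Nat.cast_nonneg _))
        (div_nonneg (Nat.cast_nonneg _) (hw.nonneg _))
    refine le_trans (mul_le_mul_of_nonneg_right s1 a1) (le_of_eq ?_)
    simp only [Pi.div_apply]
    rw [hq]
    have a2 : (m n : ℝ) ≠ 0 := (Nat.cast_pos.2 h2).ne'
    have a3 : w n ≠ 0 := (hw.pos n h3).ne'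
    have a4 : w (m n + k) ≠ 0 := (hw.pos _ (by omega)).ne'
    have a5 : ((m n + k : ℕ) : ℝ) ≠ 0 := (Nat.cast_pos.2 (by omega)).ne'
    simp only [hwdef, hν] at a3 a4 ⊢
    field_simp

end InfiniteErgodic

/-! ### The asymptotic law for the last visit -/

theorem mainTheorem9 {X : Type*} [MeasurableSpace X] (μ : Measure X) [SigmaFinite μ]
    (hμ : μ Set.univ = ∞)
    (T : X → X) (hcons : Conservative T μ) (herg : Ergodic T μ)
    (Y : Set X) (hY : MeasurableSet Y) (hY_pos : 0 < μ Y) (hY_fin : μ Y < ∞)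
    (α : ℝ) (hα : α ∈ Set.Ioo (0 : ℝ) 1)
    (l : ℝ → ℝ) (hl : InfiniteErgodic.IsSlowlyVarying l)
    (hw : (fun n : ℕ => (InfiniteErgodic.wanderingRate T μ Y n).toReal)
      ~[atTop] fun n : ℕ => (n : ℝ) ^ (1 - α) * l n)
    (hsweep : ∃ N : ℕ, 1 ≤ N ∧ InfiniteErgodic.UniformlySweeping T μ
      {u | ∃ n, N ≤ n ∧ u = InfiniteErgodic.entranceDensity T μ Y n} (Y.indicator 1))
    (H : X → ℝ) (hH : MemLp H ∞ μ)
    (hlim : Tendsto (fun n : ℕ =>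
      eLpNorm (fun x => (InfiniteErgodic.entranceDensity T μ Y n x).toReal - H x) ∞ μ)
      atTop (𝓝 0))
    (c : ℕ → ℝ) (hc_pos : ∀ n, 0 < c n) (hc_zero : Tendsto c atTop (𝓝 0))
    (hc_top : Tendsto (fun n : ℕ => c n * n) atTop atTop)
    (k : ℕ) :
    (∀ n : ℕ, 0 < n →
      μ.withDensity (fun x => ENNReal.ofReal (H x))
          {x | (InfiniteErgodic.lastVisit T Y n (T^[k] x) : ℝ) / n ≤ c n} =
        μ.withDensity ((InfiniteErgodic.transfer T μ)^[k] (fun x => ENNReal.ofReal (H x)))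
          {x | (InfiniteErgodic.lastVisit T Y n x : ℝ) / n ≤ c n}) ∧
    ((fun n : ℕ => (μ.withDensity (fun x => ENNReal.ofReal (H x))
        {x | (InfiniteErgodic.lastVisit T Y n (T^[k] x) : ℝ) / n ≤ c n}).toReal)
      ~[atTop] fun n : ℕ =>
        Real.sin (Real.pi * α) / (Real.pi * α) * (c n ^ α * l n / l (c n * n))) ∧
    ((fun n : ℕ => (μ.withDensity
        ((InfiniteErgodic.transfer T μ)^[k] (fun x => ENNReal.ofReal (H x)))
        {x | (InfiniteErgodic.lastVisit T Y n x : ℝ) / n ≤ c n}).toReal)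
      ~[atTop] fun n : ℕ =>
        Real.sin (Real.pi * α) / (Real.pi * α) * (c n ^ α * l n / l (c n * n))) := by
  open InfiniteErgodic in
  have hT : MeasurePreserving T μ μ := herg.toMeasurePreserving
  have hset : ∀ n : ℕ, 0 < n → {x | (lastVisit T Y n x : ℝ) / n ≤ c n} =
      avoids T Y ⌊c n * n⌋₊ n := fun n hn => Set.ext fun x => lastVisit_div_le_iff hn (hc_pos n)
  have hsetk : ∀ n : ℕ, 0 < n → {x | (lastVisit T Y n (T^[k] x) : ℝ) / n ≤ c n} =
      T^[k] ⁻¹' avoids T Y ⌊c n * n⌋₊ n :=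
    fun n hn => Set.ext fun x => lastVisit_div_le_iff hn (hc_pos n)
  have hid : ∀ n : ℕ, 0 < n → μ.withDensity (fun x => ENNReal.ofReal (H x))
      {x | (lastVisit T Y n (T^[k] x) : ℝ) / n ≤ c n} =
      μ.withDensity ((transfer T μ)^[k] (fun x => ENNReal.ofReal (H x)))
        {x | (lastVisit T Y n x : ℝ) / n ≤ c n} := by
    intro n hn
    rw [hset n hn, hsetk n hn, withDensity_transfer_iterate hT,
      Measure.map_apply (hT.iterate k).measurable (measurableSet_avoids hT hY _ _)]
  have hα1 : 0 < 1 - α := by linarith [hα.2]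
  have hwr := concaveRegVar_wanderingRate hT hY hY_pos hY_fin hα1 hl hw
  have hm : Tendsto (fun n : ℕ => ⌊c n * n⌋₊) atTop atTop := tendsto_nat_floor_atTop.comp hc_top
  have h1 := tendsto_limitMeasure_avoids hT hY hY_pos hY_fin hH hlim hsweep
    (by linarith [hα.1]) hwr hm (tendsto_floor_mul_self_div_self hc_zero hc_top) k
  rw [gamma_reflection hα] at h1
  have h2 := tendsto_slowlyVarying_mul hl hw hc_pos hc_top
  have hκ : 0 < Real.sin (Real.pi * α) / (Real.pi * α) :=
    div_pos (Real.sin_pos_of_pos_of_lt_pi (mul_pos Real.pi_pos hα.1)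
      (by nlinarith [Real.pi_pos, hα.2])) (mul_pos Real.pi_pos hα.1)
  have hmain : (fun n : ℕ => (μ.withDensity (fun x => ENNReal.ofReal (H x))
      {x | (lastVisit T Y n (T^[k] x) : ℝ) / n ≤ c n}).toReal) ~[atTop] fun n : ℕ =>
        Real.sin (Real.pi * α) / (Real.pi * α) * (c n ^ α * l n / l (c n * n)) := by
    have hpos : ∀ᶠ n : ℕ in atTop,
        0 < Real.sin (Real.pi * α) / (Real.pi * α) * (c n ^ α * l n / l (c n * n)) := by
      filter_upwards [eventually_gt_atTop 0] with n hn
      have hn' : (0 : ℝ) < n := Nat.cast_pos.2 hn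
      have a1 := hc_pos n
      have a2 := hl.pos n hn'
      have a3 := hl.pos (c n * n) (by positivity)
      positivity
    refine (isEquivalent_iff_tendsto_one (hpos.mono fun n hn => hn.ne')).2 ?_
    -- Both limits carry the same factor built from w(m)/m and n/w(n), so it cancels in the quotient
    -- and leaves the desired ratio.
    have h3 := h1.div (h2.const_mul (Real.sin (Real.pi * α) / (Real.pi * α))) (by simpa using hκ.ne')
    rw [mul_one, div_self hκ.ne'] at h3
    refine h3.congr' ?_
    filter_upwards [eventually_gt_atTop 0, hm.eventually_gt_atTop 0] with n hn hmn
    have a1 : (wanderingRate T μ Y ⌊c n * n⌋₊).toReal / (⌊c n * n⌋₊ : ℝ) *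
        (n / (wanderingRate T μ Y n).toReal) ≠ 0 :=
      mul_ne_zero (div_ne_zero (hwr.pos _ hmn).ne' (Nat.cast_pos.2 hmn).ne')
        (div_ne_zero (Nat.cast_pos.2 hn).ne' (hwr.pos n hn).ne')
    simp only [Pi.div_apply]
    rw [hsetk n hn, ← mul_assoc (Real.sin (Real.pi * α) / (Real.pi * α)),
      mul_div_mul_right _ _ a1]
    rfl
  refine ⟨hid, hmain, hmain.congr_left ?_⟩
  filter_upwards [eventually_gt_atTop 0] with n hn
  rw [hid n hn]
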